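/- **Setting.** Let $X$ be a real Banach space with dual $X^*$, let $f:X\to\mathbb R\cup\{+\infty\}$ be lower semicontinuous and $\bar x\in\mathrm{dom}(f)=\{f<+\infty\}$. For $u^*\in X^*$ put $f_{u^*}:=f-u^*$. Here $B(\cdot,r)$, $B[\cdot,r]$ are the open and closed balls, $B_X=B[0,1]$, and $d(x,\emptyset)=+\infty$. A function $\varphi:\mathbb R_+\to\mathbb R_+$ is *admissible* if it is nondecreasing, $\varphi(0)=0$, and $\varphi(t)\to0$ implies $t\to0$. Let $\partial f$ be the Clarke–Rockafellar subdifferential: $\partial f(x)=\{x^*\in X^*:\langle x^*,h\rangle\le f^\uparrow(x,h)\ \forall h\in X\}$ for $x\in\mathrm{dom}(f)$ and $\partial f(x)=\emptyset$ otherwise, where $$f^\uparrow(x,h)=\lim_{\varepsilon\downarrow0}\ \limsup_{u\to x,\ f(u)\to f(x),\ t\downarrow0}\ \inf_{w\in h+\varepsilon B_X}\frac{f(u+tw)-f(u)}{t}.$$ **Notions.** * $\varphi$-SLWP at $\bar x$: there are $\delta,r,\tau,\kappa>0$ such that for every $u^*\in B(0,\delta)$ there is $x_{u^*}\in B[\bar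 x,r]$, with $x_0=\bar x$, satisfying $\varphi(\kappa\|x-x_{u^*}\|)\le\tau\,(f_{u^*}(x)-f_{u^*}(x_{u^*}))$ for all $x\in B[\bar x,r]$. * $\varphi$-SWLWP at $\bar x$: there are $r,\gamma,\delta,\tau,\kappa>0$ such that $f(\bar x)=\min_{B[\bar x,r]}f$ and, for all $(x,u^*)\in B(\bar x,\gamma)\times B(0,\delta)$, the minimum of $f_{u^*}$ on $B[\bar x,r]$ is attained and $\varphi\big(\tau\, d(x,\arg\min_{B[\bar x,r]}f_{u^*})\big)\le\kappa\,\big(f_{u^*}(x)-\min_{B[\bar x,r]}f_{u^*}\big)$. * $\psi$-TSLM at $\bar x$: there are $\delta,r,\kappa,\tau>0$ and $M:B(0,\delta)\to B[\bar x,r]$ with $M(0)=\bar x$, $M(u^*)\in\arg\min_{B(\bar x,r)}f_{u^*}$ and $\kappa\|M(u^*)-M(v^*)\|\le\psi(\tau\|u^*-v^*\|)$ for all $u^*,v^*\in B(0,\delta)$. * weak $\psi$-TSLM at $\bar x$: there are $r,\gamma,\kappa,\delta,\tau>0$ such that $f(\bar x)=\min_{B[\bar x,r]}f$ and $\arg\min_{B[\bar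 x,r]}f_{v^*}\cap B(\bar x,\gamma)\subset\arg\min_{B[\bar x,r]}f_{u^*}+\kappa\,\psi(\tau\|v^*-u^*\|)B_X$ for all $u^*,v^*\in B(0,\delta)$. * $F:X\rightrightarrows X^*$ is *metrically $\psi$-regular* at $(\bar x,0)$ if $0\in F(\bar x)$ and there are $r,\tau,\kappa>0$ with $\psi(\tau\, d(x,F^{-1}(y)))\le\kappa\, d(y,F(x))$ for all $(x,y)\in B(\bar x,r)\times B(0,r)$ (with $\psi(+\infty)=+\infty$). It is *strongly metrically $\psi$-regular* at $(\bar x,0)$ if $0\in F(\bar x)$ and there are $r,\tau,\kappa,\delta>0$ such that in addition to this inequality $F^{-1}(y)\cap B(\bar x,\delta)$ is a singleton for all $y\in B(0,r)$. **Statement.** Let $\varphi:\mathbb R_+\to\mathbb R_+$ be a differentiable, strictly convex admissible function with $\varphi'(0)=0$. Let $(\varphi')^{-1}$ be the inverse of $\varphi':\mathbb R_+\to\mathbb R_+$, with $(\varphi')^{-1}(s)=+\infty$ if $s$ is not a value of $\varphi'$. Consider: 1. $f$ has $\varphi$-SLWP at $\bar x$; 2. $f$ has $\varphi$-SWLWP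 at $\bar x$; 3. $f$ has $(\varphi')^{-1}$-TSLM at $\bar x$; 4. $f$ has weak $(\varphi')^{-1}$-TSLM at $\bar x$; 5. $\partial f$ is strongly metrically $\varphi'$-regular at $(\bar x,0)$; 6. $\partial f$ is metrically $\varphi'$-regular at $(\bar x,0)$. Then (1), (2), (3), (4) are equivalent, (5) implies (6), and, if $\bar x$ is a local minimizer of $f$, (5) implies (1)–(4). If $f$ is convex, then (1)–(6) are all equivalent (without assuming that $\bar x$ is a local minimizer). -/

import Mathlib

open Set Filter Topology Metric
open scoped ENNReal

namespace TiltStability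

/-! ### Admissible functions

A function on `ℝ₊ = [0, ∞)` is represented by a function `ℝ → ℝ` of which only the values on
`[0, ∞)` are ever used. -/

/-- `φ : ℝ₊ → ℝ₊` is admissible: nondecreasing, `φ 0 = 0`, and `φ(t) → 0` implies `t → 0`. -/
structure IsAdmissible (φ : ℝ → ℝ) : Prop where
  nonneg : ∀ t, 0 ≤ t → 0 ≤ φ t
  monotoneOn : MonotoneOn φ (Ici 0)
  map_zero : φ 0 = 0
  tendsto_zero : ∀ t : ℕ → ℝ, (∀ n, 0 ≤ t n) →
    Tendsto (fun n => φ (t n)) atTop (𝓝 0) → Tendsto t atTop (𝓝 0)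

/-- The derivative of `φ` as a function on `[0, ∞)` (one-sided at `0`). -/
noncomputable def derivPos (φ : ℝ → ℝ) (t : ℝ) : ℝ := derivWithin φ (Ici 0) t

/-- The inverse function of an injective `g : [0, ∞) → ℝ`: its value at `s` is the unique `t ≥ 0`
with `g t = s`, and `+∞` if `s` is not a value of `g` on `[0, ∞)`. -/
noncomputable def invPos (g : ℝ → ℝ) (s : ℝ) : ℝ≥0∞ :=
  ⨅ (t : ℝ) (_ : 0 ≤ t) (_ : g t = s), ENNReal.ofReal t

theorem invPos_apply {g : ℝ → ℝ} (hg : InjOn g (Ici 0)) {t : ℝ} (ht : 0 ≤ t) :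
    invPos g (g t) = ENNReal.ofReal t := by
  refine le_antisymm (iInf_le_of_le t (iInf_le_of_le ht (iInf_le_of_le rfl le_rfl))) ?_
  refine le_iInf fun s => le_iInf fun hs => le_iInf fun h => ?_
  rw [hg hs ht h]

theorem invPos_eq_top {g : ℝ → ℝ} {s : ℝ} (hs : ∀ t, 0 ≤ t → g t ≠ s) :
    invPos g s = ⊤ := by
  simp only [invPos, iInf_eq_top]
  exact fun t ht h => absurd h (hs t ht)

/-! ### Tilted functions, minimizers, convexity, Clarke–Rockafellar subdifferential -/

section Functions

variable {X : Type*} [NormedAddCommGroup X] [NormedSpace ℝ X]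

/-- The tilted function `f_u = f - u`. -/
noncomputable def tilt (f : X → EReal) (u : StrongDual ℝ X) (x : X) : EReal :=
  f x - ((u x : ℝ) : EReal)

/-- The set of minimizers of `g` on `S`. -/
def argminOn (g : X → EReal) (S : Set X) : Set X :=
  {x | x ∈ S ∧ ∀ z ∈ S, g x ≤ g z}

/-- Convexity of an extended real valued function that never takes the value `-∞`. -/
def ConvexFun (f : X → EReal) : Prop :=
  ∀ (x y : X) (a b : ℝ), 0 < a → 0 < b → a + b = 1 →
    f (a • x + b • y) ≤ (a : EReal) * f x + (b : EReal) * f y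

/-- Rockafellar's generalized directional derivative at a point `x` of the effective domain,
`f^↑(x, h) = lim_{ε ↓ 0} limsup_{u →_f x, t ↓ 0} inf_{w ∈ h + ε B_X} (f (u + t w) - f u) / t`,
where `u →_f x` means `u → x` and `f u → f x`.
The limsup does not decrease when `ε` decreases, so that the limit as `ε ↓ 0` is a supremum. -/
noncomputable def upDeriv (f : X → EReal) (x h : X) : EReal :=
  ⨆ (ε : ℝ) (_ : 0 < ε),
    limsup (fun p : X × ℝ =>
        ⨅ w ∈ closedBall h ε, (f (p.1 + p.2 • w) - f p.1) / (p.2 : EReal))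
      ((𝓝 x ⊓ comap f (𝓝 (f x))) ×ˢ 𝓝[>] (0 : ℝ))

/-- The Clarke–Rockafellar subdifferential, empty outside the effective domain. -/
def subdiff (f : X → EReal) (x : X) : Set (StrongDual ℝ X) :=
  {u | f x ≠ ⊤ ∧ ∀ h : X, ((u h : ℝ) : EReal) ≤ upDeriv f x h}

/-! ### Stability notions -/

/-- Stable local well-posedness of `f` at `a` with respect to `φ` (`φ`-SLWP);
`m u` is the point `x_u`. -/
def SLWP (φ : ℝ → ℝ) (f : X → EReal) (a : X) : Prop :=
  ∃ δ r τ κ : ℝ, 0 < δ ∧ 0 < r ∧ 0 < τ ∧ 0 < κ ∧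
    ∃ m : StrongDual ℝ X → X, m 0 = a ∧
      ∀ u ∈ ball (0 : StrongDual ℝ X) δ, m u ∈ closedBall a r ∧
        ∀ x ∈ closedBall a r,
          ((φ (κ * ‖x - m u‖) : ℝ) : EReal) ≤ (τ : EReal) * (tilt f u x - tilt f u (m u))

/-- Stable weak local well-posedness of `f` at `a` with respect to `φ` (`φ`-SWLWP). The minima
of the tilted functions on the closed ball are part of the notion, so they have to be attained. -/
def SWLWP (φ : ℝ → ℝ) (f : X → EReal) (a : X) : Prop :=
  ∃ r γ δ τ κ : ℝ, 0 < r ∧ 0 < γ ∧ 0 < δ ∧ 0 < τ ∧ 0 < κ ∧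
    a ∈ argminOn f (closedBall a r) ∧
      ∀ x ∈ ball a γ, ∀ u ∈ ball (0 : StrongDual ℝ X) δ,
        (argminOn (tilt f u) (closedBall a r)).Nonempty ∧
        ((φ (τ * infDist x (argminOn (tilt f u) (closedBall a r))) : ℝ) : EReal) ≤
          (κ : EReal) * (tilt f u x - ⨅ z ∈ closedBall a r, tilt f u z)

/-- `ψ`-tilt-stable local minimum of `f` at `a` (`ψ`-TSLM). -/
def TSLM (ψ : ℝ → ℝ≥0∞) (f : X → EReal) (a : X) : Prop :=
  ∃ δ r κ τ : ℝ, 0 < δ ∧ 0 < r ∧ 0 < κ ∧ 0 < τ ∧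
    ∃ M : StrongDual ℝ X → X, M 0 = a ∧
      (∀ u ∈ ball (0 : StrongDual ℝ X) δ,
        M u ∈ closedBall a r ∧ M u ∈ argminOn (tilt f u) (ball a r)) ∧
      ∀ u ∈ ball (0 : StrongDual ℝ X) δ, ∀ v ∈ ball (0 : StrongDual ℝ X) δ,
        ENNReal.ofReal κ * ‖M u - M v‖ₑ ≤ ψ (τ * ‖u - v‖)

/-- Weak `ψ`-tilt-stable local minimum of `f` at `a` (weak `ψ`-TSLM): `a` minimizes `f` on the
closed ball (automatic if `a` is a minimizer of `f`), and
`argmin f_v ∩ B(a, γ) ⊆ argmin f_u + κ ψ(τ ‖v - u‖) B_X` for all small `u`, `v`. -/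
def WeakTSLM (ψ : ℝ → ℝ≥0∞) (f : X → EReal) (a : X) : Prop :=
  ∃ r γ κ δ τ : ℝ, 0 < r ∧ 0 < γ ∧ 0 < κ ∧ 0 < δ ∧ 0 < τ ∧
    a ∈ argminOn f (closedBall a r) ∧
      ∀ v ∈ ball (0 : StrongDual ℝ X) δ, ∀ u ∈ ball (0 : StrongDual ℝ X) δ,
        argminOn (tilt f v) (closedBall a r) ∩ ball a γ ⊆
          {x | ∃ z ∈ argminOn (tilt f u) (closedBall a r),
            ‖x - z‖ₑ ≤ ENNReal.ofReal κ * ψ (τ * ‖v - u‖)}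

end Functions

/-! ### Metric regularity of multifunctions -/

section Regularity

variable {X Y : Type*} [NormedAddCommGroup X] [NormedAddCommGroup Y]

/-- The inverse multifunction. -/
def invMulti (F : X → Set Y) (y : Y) : Set X := {x | y ∈ F x}

/-- `ψ (τ d(x, F⁻¹ y)) ≤ κ d(y, F x)` for `(x, y) ∈ B(a, r) × B(b, r)`, with the convention that
the distance to the empty set is `+∞`: nothing is required if `F x = ∅`, and `F⁻¹ y = ∅` is not
allowed if `F x ≠ ∅`. -/
def RegIneq (ψ : ℝ → ℝ) (F : X → Set Y) (a : X) (b : Y) (r τ κ : ℝ) : Prop :=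
  ∀ x ∈ ball a r, ∀ y ∈ ball b r, (F x).Nonempty →
    (invMulti F y).Nonempty ∧ ψ (τ * infDist x (invMulti F y)) ≤ κ * infDist y (F x)

/-- `F` is metrically `ψ`-regular at the point `(a, b)` of its graph. -/
def MetricRegular (ψ : ℝ → ℝ) (F : X → Set Y) (a : X) (b : Y) : Prop :=
  b ∈ F a ∧ ∃ r τ κ : ℝ, 0 < r ∧ 0 < τ ∧ 0 < κ ∧ RegIneq ψ F a b r τ κ

/-- `F` is strongly metrically `ψ`-regular at the point `(a, b)` of its graph. -/
def StrongMetricRegular (ψ : ℝ → ℝ) (F : X → Set Y) (a : X) (b : Y) : Prop :=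
  b ∈ F a ∧ ∃ r τ κ δ : ℝ, 0 < r ∧ 0 < τ ∧ 0 < κ ∧ 0 < δ ∧ RegIneq ψ F a b r τ κ ∧
    ∀ y ∈ ball b r, ∃ x, invMulti F y ∩ ball a δ = {x}

end Regularity

end TiltStability

namespace TiltStability

/-! Write `g = φ'`. Convexity gives `φ t ≤ t * g t ≤ φ (2 * t)`, so up to constants a growth
condition with gauge `φ` and a displacement bound with rate `g` are the same thing.

The four stability notions are linked by the cycle 1 → 2 → 4 → 3 → 1, with neither lower
semicontinuity nor convexity of `f`. Growth bounds the displacement of minimizers because the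
minimality inequalities for the tilts `u` and `v` add up to `φ(κ‖x - z‖) ≤ τ ‖v - u‖ ‖x - z‖`.
Conversely, tilt further along a functional norming `x - M v`, just strongly enough that the
minimizer moves at most half way to `x`; the two minimality inequalities then produce growth at `x`.
The same kind of tilt separates two distinct minimizers, so weak tilt stability already forces
uniqueness.

Metric regularity gives growth through Ekeland's principle: near a point of small excess there is a
point with a subgradient close to `u`, and regularity bounds its distance to the critical set
(`RegIneq.gauge_le`). The subgradient comes from a sum rule, by Hahn–Banach and the subadditivity of
`f^↑`. In the nonconvex case local minimality makes the critical point an actual minimizer; in the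
convex case every critical point is a global minimizer, which also gives the converse. -/

/-! ### Rates: a convex gauge and its derivative -/

/-- The properties of a strictly convex gauge `φ` and its derivative `g` on `[0, ∞)` used for the
stability estimates. -/
structure IsRate (φ g : ℝ → ℝ) : Prop where
  map_zero : g 0 = 0
  strictMonoOn : StrictMonoOn g (Ici 0)
  le_mul : ∀ t, 0 ≤ t → φ t ≤ t * g t
  mul_le : ∀ t, 0 ≤ t → t * g t ≤ φ (2 * t)
  surj : ∀ t s, 0 ≤ t → 0 ≤ s → s ≤ g t → ∃ t', 0 ≤ t' ∧ t' ≤ t ∧ g t' = s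

/-- The derivative at `t` lies between the slopes of `φ` on `[0, t]` and on `[t, 2t]`. Darboux's
theorem supplies intermediate values, so continuity of `φ'` is not needed; its range may be bounded.
-/
theorem isRate_derivPos {φ : ℝ → ℝ} (hφ : IsAdmissible φ)
    (hdiff : DifferentiableOn ℝ φ (Ici 0)) (hconv : StrictConvexOn ℝ (Ici 0) φ)
    (hzero : derivPos φ 0 = 0) : IsRate φ (derivPos φ) where
  map_zero := hzero
  strictMonoOn := hconv.strictMonoOn_derivWithin hdiff
  le_mul t ht := by
    rcases ht.eq_or_lt with rfl | h
    · simp [hφ.map_zero]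
    have := hconv.convexOn.slope_le_derivWithin (mem_Ici.2 le_rfl) (mem_Ici.2 ht) h
      (hdiff t (mem_Ici.2 ht))
    rw [slope_def_field, hφ.map_zero, sub_zero, sub_zero, div_le_iff₀ h] at this
    rw [mul_comm]
    exact this
  mul_le t ht := by
    rcases ht.eq_or_lt with rfl | h
    · simp [hφ.map_zero]
    have := hconv.convexOn.derivWithin_le_slope (mem_Ici.2 ht)
      (mem_Ici.2 (by linarith : 0 ≤ 2 * t)) (by linarith) (hdiff t (mem_Ici.2 ht))
    rw [slope_def_field, show 2 * t - t = t by ring, le_div_iff₀ h] at this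
    have h2 := hφ.nonneg t ht
    have h3 : derivWithin φ (Ici 0) t * t = t * derivPos φ t := mul_comm _ _
    linarith
  surj t s ht hs hst := by
    rcases hs.eq_or_lt with rfl | hs
    · exact ⟨0, le_rfl, ht, hzero⟩
    rcases hst.eq_or_lt with rfl | hst
    · exact ⟨t, ht, le_rfl, rfl⟩
    obtain ⟨c, hc, hcs⟩ := exists_hasDerivWithinAt_eq_of_gt_of_lt (f := φ) (f' := derivPos φ) ht
      (fun x hx => ((hdiff x hx.1).hasDerivWithinAt).mono Icc_subset_Ici_self)
      (by rw [hzero]; exact hs) hst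
    exact ⟨c, hc.1.le, hc.2.le, hcs⟩

namespace IsRate

variable {φ g : ℝ → ℝ}

theorem pos (h : IsRate φ g) {t : ℝ} (ht : 0 < t) : 0 < g t := by
  have := h.strictMonoOn (mem_Ici.2 le_rfl) (mem_Ici.2 ht.le) ht
  rwa [h.map_zero] at this

theorem nonneg (h : IsRate φ g) {t : ℝ} (ht : 0 ≤ t) : 0 ≤ g t := by
  rcases ht.eq_or_lt with rfl | ht
  · exact h.map_zero.ge
  · exact (h.pos ht).le

theorem gauge_zero (h : IsRate φ g) : φ 0 = 0 := by
  have h1 := h.le_mul 0 le_rfl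
  have h2 := h.mul_le 0 le_rfl
  simp only [mul_zero, zero_mul] at h1 h2
  exact le_antisymm h1 h2

theorem gauge_pos (h : IsRate φ g) {t : ℝ} (ht : 0 < t) : 0 < φ t := by
  have h1 := h.mul_le (t / 2) (by positivity)
  rw [show 2 * (t / 2) = t by ring] at h1
  have := h.pos (half_pos ht)
  exact lt_of_lt_of_le (by positivity) h1

theorem injOn (h : IsRate φ g) : InjOn g (Ici 0) := h.strictMonoOn.injOn

theorem mono (h : IsRate φ g) {s t : ℝ} (hs : 0 ≤ s) (hst : s ≤ t) : g s ≤ g t :=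
  h.strictMonoOn.monotoneOn (mem_Ici.2 hs) (mem_Ici.2 (hs.trans hst)) hst

theorem lt_of_lt (h : IsRate φ g) {s t : ℝ} (ht : 0 ≤ t) (hst : g s < g t) : s < t := by
  by_contra hc
  exact absurd (h.mono ht (not_lt.1 hc)) (not_le.2 hst)

theorem le_of_le (h : IsRate φ g) {s t : ℝ} (hs : 0 ≤ s) (ht : 0 ≤ t) (hst : g s ≤ g t) :
    s ≤ t :=
  (h.strictMonoOn.le_iff_le (mem_Ici.2 hs) (mem_Ici.2 ht)).1 hst

/-- The rate takes arbitrarily small positive values at positive points. -/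
theorem exists_pos_le (h : IsRate φ g) {s : ℝ} (hs : 0 < s) : ∃ t, 0 < t ∧ g t ≤ s := by
  by_cases hc : g 1 ≤ s
  · exact ⟨1, one_pos, hc⟩
  obtain ⟨t, ht, -, hts⟩ := h.surj 1 s zero_le_one hs.le (not_le.1 hc).le
  refine ⟨t, ht.lt_of_ne ?_, hts.le⟩
  rintro rfl
  rw [h.map_zero] at hts
  exact hs.ne hts

/-- `t ≤ g⁻¹ s` if `g t ≤ s`. -/
theorem ofReal_le_invPos (h : IsRate φ g) {s t : ℝ} (ht : 0 ≤ t) (hst : g t ≤ s) :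
    ENNReal.ofReal t ≤ invPos g s := by
  refine le_iInf fun t' => le_iInf fun ht' => le_iInf fun hs => ENNReal.ofReal_le_ofReal ?_
  exact h.le_of_le ht ht' (hst.trans hs.ge)

/-- `g⁻¹ s ≤ t` if `s ≤ g t`. -/
theorem invPos_le_ofReal (h : IsRate φ g) {s t : ℝ} (ht : 0 ≤ t) (hs : 0 ≤ s) (hst : s ≤ g t) :
    invPos g s ≤ ENNReal.ofReal t := by
  obtain ⟨t', ht', htt, rfl⟩ := h.surj t s ht hs hst
  rw [invPos_apply h.injOn ht']
  exact ENNReal.ofReal_le_ofReal htt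

/-- The basic estimate: a growth inequality turns into an inequality for the rate. -/
theorem le_of_gauge_le (h : IsRate φ g) {κ τ d c : ℝ} (hκ : 0 < κ) (hd : 0 ≤ d) (hc : 0 ≤ c)
    (hτ : 0 ≤ τ) (hle : φ (κ * d) ≤ τ * (c * d)) : g (κ / 2 * d) ≤ 2 * τ / κ * c := by
  rcases hd.eq_or_lt with rfl | hd
  · rw [mul_zero, h.map_zero]; positivity
  -- Evaluated at `κ d / 2`, the doubling inequality reproduces `φ (κ d)`; one factor `d` then
  -- cancels.
  have h1 := h.mul_le (κ / 2 * d) (by positivity)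
  rw [show 2 * (κ / 2 * d) = κ * d by ring] at h1
  have h2 : κ / 2 * d * g (κ / 2 * d) ≤ κ / 2 * d * (2 * τ / κ * c) := by
    calc _ ≤ _ := h1.trans hle
      _ = _ := by field_simp
  exact le_of_mul_le_mul_left h2 (by positivity)

end IsRate

/-! ### Extended real inequalities for tilted functions -/

theorem iInf_eq_of_mem_argminOn {X : Type*} {h : X → EReal} {z : X} {S : Set X}
    (hz : z ∈ argminOn h S) :
    ⨅ y ∈ S, h y = h z :=
  le_antisymm (iInf₂_le z hz.1) (le_iInf₂ hz.2)

theorem exists_eq_coe {X : Type*} {f : X → EReal} {x : X} (hbot : ∀ x, f x ≠ ⊥)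
    (hx : f x ≠ ⊤) : ∃ c : ℝ, f x = c :=
  ⟨(f x).toReal, (EReal.coe_toReal hx (hbot x)).symm⟩

section Tilt

variable {X : Type*} [NormedAddCommGroup X] [NormedSpace ℝ X] {f : X → EReal}
  {u : StrongDual ℝ X} {x y z : X}

/-- The additive form avoids subtraction in `EReal`: only real numbers are added to values of `f`.
-/
theorem tilt_le_tilt_iff (hx : f x ≠ ⊥) (hz : f z ≠ ⊥) :
    tilt f u z ≤ tilt f u x ↔ f z + ((u (x - z) : ℝ) : EReal) ≤ f x := by
  unfold tilt
  generalize f x = p at *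
  generalize f z = q at *
  rw [map_sub]
  induction p with
  | bot => simp at hx
  | top => simp
  | coe p =>
    induction q with
    | bot => simp at hz
    | top => simp [← EReal.coe_sub]
    | coe q =>
      norm_cast
      constructor <;> intro h <;> linarith

theorem mem_argminOn_tilt_iff (hbot : ∀ x, f x ≠ ⊥) {S : Set X} :
    z ∈ argminOn (tilt f u) S ↔ z ∈ S ∧ ∀ y ∈ S, f z + ((u (y - z) : ℝ) : EReal) ≤ f y := by
  unfold argminOn
  simp only [mem_ofPred_eq, tilt_le_tilt_iff (hbot _) (hbot z)]

/-- Subtracting `⊤` in `EReal` gives `⊥`, even from `⊤`; hence the inequality itself forces `f z` to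
be finite. -/
theorem coe_le_mul_tilt_sub_tilt_iff (hx : f x ≠ ⊥) (hz : f z ≠ ⊥) {c τ : ℝ} (hτ : 0 < τ) :
    (c : EReal) ≤ (τ : EReal) * (tilt f u x - tilt f u z) ↔
      f z ≠ ⊤ ∧ f z + ((c / τ + u (x - z) : ℝ) : EReal) ≤ f x := by
  unfold tilt
  generalize f x = p at *
  generalize f z = q at *
  rw [map_sub]
  induction q with
  | bot => simp at hz
  | top => simp [EReal.coe_mul_bot_of_pos hτ]
  | coe q =>
    induction p with
    | bot => simp at hx
    | top => simp [← EReal.coe_sub, EReal.coe_mul_top_of_pos hτ]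
    | coe p =>
      simp only [ne_eq, EReal.coe_ne_top, not_false_eq_true, true_and]
      norm_cast
      rw [← div_le_iff₀' hτ]
      constructor <;> intro h <;> linarith

theorem ne_top_of_mem_argminOn (hbot : ∀ x, f x ≠ ⊥) {S : Set X}
    (hz : z ∈ argminOn (tilt f u) S) (hx : x ∈ S) (hfx : f x ≠ ⊤) : f z ≠ ⊤ := by
  intro h
  have := ((mem_argminOn_tilt_iff hbot).1 hz).2 x hx
  rw [h, EReal.top_add_coe, top_le_iff] at this
  exact hfx this

theorem tilt_zero : tilt f (0 : StrongDual ℝ X) = f := by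
  ext x; simp [tilt]

end Tilt

/-! ### Ekeland's variational principle -/

section Ekeland

variable {α : Type*} [MetricSpace α] [CompleteSpace α]

/-- Ekeland's variational principle for real valued functions. -/
theorem ekeland_real {G : α → ℝ} (hG : LowerSemicontinuous G) {m : ℝ} (hm : ∀ y, m ≤ G y)
    {l : ℝ} (hl : 0 < l) (x₀ : α) :
    ∃ x, G x + l * dist x₀ x ≤ G x₀ ∧ ∀ y, G x ≤ G y + l * dist x y := by
  -- Lower sections of Ekeland's order; they are closed, and the order is reflexive and transitive.
  let S : α → Set α := fun x => {y | G y + l * dist x y ≤ G x}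
  have hself : ∀ x, x ∈ S x := fun x => by simp [S]
  have htrans : ∀ {x y z}, y ∈ S x → z ∈ S y → z ∈ S x := by
    intro x y z hy hz
    simp only [S, mem_ofPred_eq] at *
    nlinarith [dist_triangle x y z]
  have hclosed : ∀ x, IsClosed (S x) := fun x =>
    (hG.add (continuous_const.mul (continuous_const.dist continuous_id)).lowerSemicontinuous
      ).isClosed_preimage (G x)
  -- The next point descends at least half of the way from `G x` to the infimum of `G` over `S x`.
  have hnext : ∀ x, ∃ y ∈ S x, ∀ z ∈ S x, G y ≤ (G z + G x) / 2 := by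
    intro x
    have hbdd : BddBelow (G '' S x) := ⟨m, by rintro _ ⟨y, -, rfl⟩; exact hm y⟩
    have hle : ∀ z ∈ S x, sInf (G '' S x) ≤ G z := fun z hz => csInf_le hbdd ⟨z, hz, rfl⟩
    rcases (hle x (hself x)).eq_or_lt with h | h
    · exact ⟨x, hself x, fun z hz => by linarith [hle z hz]⟩
    · obtain ⟨_, ⟨y, hy, rfl⟩, hlt⟩ := exists_lt_of_csInf_lt (s := G '' S x)
        ⟨_, x, hself x, rfl⟩ (show sInf (G '' S x) < (sInf (G '' S x) + G x) / 2 by linarith)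
      exact ⟨y, hy, fun z hz => by linarith [hle z hz]⟩
  choose nxt hnxt hnxt' using hnext
  let s : ℕ → α := fun n => nxt^[n] x₀
  have hs : ∀ n, s (n + 1) = nxt (s n) := fun n => Function.iterate_succ_apply' nxt n x₀
  have hmem : ∀ n k, s (n + k) ∈ S (s n) := by
    intro n k
    induction k with
    | zero => exact hself _
    | succ k ih =>
      refine htrans ih ?_
      rw [← add_assoc, hs]
      exact hnxt _
  have hanti : Antitone (fun n => G (s n)) := by
    refine antitone_nat_of_succ_le fun n => ?_
    have := hmem n 1
    simp only [S, mem_ofPred_eq] at this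
    nlinarith [dist_nonneg (x := s n) (y := s (n + 1))]
  have hlim := tendsto_atTop_ciInf hanti ⟨m, by rintro _ ⟨n, rfl⟩; exact hm _⟩
  set ℓ := ⨅ n, G (s n)
  have hℓ : ∀ n, ℓ ≤ G (s n) := fun n => hanti.le_of_tendsto hlim n
  have hcauchy : CauchySeq s := by
    refine cauchySeq_of_le_tendsto_0' (fun n => (G (s n) - ℓ) / l) ?_ ?_
    · intro n k hnk
      obtain ⟨j, rfl⟩ := Nat.exists_eq_add_of_le hnk
      have := hmem n j
      simp only [S, mem_ofPred_eq] at this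
      rw [le_div_iff₀ hl]
      linarith [hℓ (n + j)]
    · simpa using (hlim.sub_const ℓ).div_const l
  obtain ⟨x, hx⟩ := cauchySeq_tendsto_of_complete hcauchy
  have hxS : ∀ n, x ∈ S (s n) := fun n =>
    (hclosed (s n)).mem_of_tendsto hx (eventually_atTop.2 ⟨n, fun k hk => by
      obtain ⟨j, rfl⟩ := Nat.exists_eq_add_of_le hk
      exact hmem n j⟩)
  have hxℓ : G x ≤ ℓ := by
    refine le_ciInf fun n => ?_
    have := hxS n
    simp only [S, mem_ofPred_eq] at this
    nlinarith [dist_nonneg (x := s n) (y := x)]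
  refine ⟨x, hxS 0, fun y => ?_⟩
  by_cases hy : y ∈ S x
  -- A point `y` below the limit lies in every section, so the halving estimate passes to the limit
  -- and gives `ℓ ≤ G y`.
  · have h1 : ∀ n, G (s (n + 1)) ≤ (G y + G (s n)) / 2 := fun n => by
      rw [hs]
      exact hnxt' _ _ (htrans (hxS n) hy)
    have h2 : ℓ ≤ (G y + ℓ) / 2 := le_of_tendsto_of_tendsto'
      ((tendsto_add_atTop_iff_nat 1).2 hlim) ((hlim.const_add _).div_const 2) h1
    have : 0 ≤ l * dist x y := by positivity
    linarith
  · simp only [S, mem_ofPred_eq, not_le] at hy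
    exact hy.le

/-- Ekeland's variational principle for extended real valued functions. -/
theorem ekeland {F : α → EReal} (hF : LowerSemicontinuous F) {m : ℝ} (hm : ∀ y, (m : EReal) ≤ F y)
    {l : ℝ} (hl : 0 < l) {x₀ : α} (hx₀ : F x₀ ≠ ⊤) :
    ∃ x, F x + ((l * dist x₀ x : ℝ) : EReal) ≤ F x₀ ∧
      ∀ y, F x ≤ F y + ((l * dist x y : ℝ) : EReal) := by
  -- On this sublevel set `F` is finite; outside it `F` exceeds `F x₀`, so the conclusion is trivial
  -- there.
  have hcl : IsClosed {y | F y ≤ F x₀} := hF.isClosed_preimage (F x₀)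
  have : CompleteSpace {y | F y ≤ F x₀} := hcl.completeSpace_coe
  have hfin : ∀ y : {y | F y ≤ F x₀}, ((F y).toReal : EReal) = F y := fun y =>
    EReal.coe_toReal (ne_top_of_le_ne_top hx₀ y.2)
      (ne_bot_of_le_ne_bot (EReal.coe_ne_bot m) (hm y))
  obtain ⟨x, hx, hmin⟩ := ekeland_real (G := fun y : {y | F y ≤ F x₀} => (F y).toReal)
    (by
      intro y c hc
      have : (c : EReal) < F y := by rw [← hfin y]; exact_mod_cast hc
      filter_upwards [continuous_subtype_val.continuousAt.eventually (hF y c this)] with z hz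
      have hz : (c : EReal) < F z := hz
      rw [← hfin z] at hz
      change c < (F z).toReal
      exact_mod_cast hz)
    (m := m) (fun y => by have := hm y; rw [← hfin y] at this; exact_mod_cast this) hl
    ⟨x₀, le_refl (F x₀)⟩
  refine ⟨x, ?_, fun y => ?_⟩
  · have hx' : (F x).toReal + l * dist x₀ (x : α) ≤ (F x₀).toReal := hx
    calc F x + ((l * dist x₀ (x : α) : ℝ) : EReal)
        = ((F x).toReal : EReal) + ((l * dist x₀ (x : α) : ℝ) : EReal) := by rw [hfin x]
      _ ≤ ((F x₀).toReal : EReal) := by exact_mod_cast hx'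
      _ = F x₀ := hfin ⟨x₀, le_refl (F x₀)⟩
  · by_cases hy : F y ≤ F x₀
    · rw [← hfin x, ← hfin ⟨y, hy⟩]
      exact_mod_cast hmin ⟨y, hy⟩
    · refine (x.2.trans (not_le.1 hy).le).trans ?_
      exact le_add_of_nonneg_right (by exact_mod_cast (by positivity : 0 ≤ l * dist (x : α) y))

end Ekeland

/-! ### Equivalence of well-posedness and tilt stability -/

theorem ofReal_mul_enorm_le_iff {E : Type*} [NormedAddCommGroup E] {κ t : ℝ} {w : E}
    (hκ : 0 ≤ κ) (ht : 0 ≤ t) :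
    ENNReal.ofReal κ * ‖w‖ₑ ≤ ENNReal.ofReal t ↔ κ * ‖w‖ ≤ t := by
  rw [← ofReal_norm, ← ENNReal.ofReal_mul hκ, ENNReal.ofReal_le_ofReal_iff ht]

section Growth

variable {X : Type*} [NormedAddCommGroup X] [NormedSpace ℝ X]

theorem apply_le_norm_mul (u : StrongDual ℝ X) (x : X) : u x ≤ ‖u‖ * ‖x‖ :=
  (le_abs_self _).trans (u.le_opNorm x)

/-- `z` is a sharp minimizer of `f - u` on `S` with growth `x ↦ φ (κ ‖x - z‖) / τ`. -/
def GrowthAt (φ : ℝ → ℝ) (τ κ : ℝ) (f : X → EReal) (u : StrongDual ℝ X) (S : Set X) (z : X) :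
    Prop :=
  z ∈ S ∧ f z ≠ ⊤ ∧ ∀ x ∈ S, f z + ((φ (κ * ‖x - z‖) / τ + u (x - z) : ℝ) : EReal) ≤ f x

variable {φ g : ℝ → ℝ} {f : X → EReal} {a : X}

theorem slwp_iff (hbot : ∀ x, f x ≠ ⊥) :
    SLWP φ f a ↔ ∃ δ r τ κ : ℝ, 0 < δ ∧ 0 < r ∧ 0 < τ ∧ 0 < κ ∧
      ∃ m : StrongDual ℝ X → X, m 0 = a ∧
        ∀ u ∈ ball (0 : StrongDual ℝ X) δ, GrowthAt φ τ κ f u (closedBall a r) (m u) := by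
  constructor
  · rintro ⟨δ, r, τ, κ, hδ, hr, hτ, hκ, m, hm, h⟩
    refine ⟨δ, r, τ, κ, hδ, hr, hτ, hκ, m, hm, fun u hu => ?_⟩
    have h' := fun x hx => (coe_le_mul_tilt_sub_tilt_iff (hbot x) (hbot _) hτ).1 ((h u hu).2 x hx)
    exact ⟨(h u hu).1, (h' a (mem_closedBall_self hr.le)).1, fun x hx => (h' x hx).2⟩
  · rintro ⟨δ, r, τ, κ, hδ, hr, hτ, hκ, m, hm, h⟩
    exact ⟨δ, r, τ, κ, hδ, hr, hτ, hκ, m, hm, fun u hu => ⟨(h u hu).1, fun x hx =>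
      (coe_le_mul_tilt_sub_tilt_iff (hbot x) (hbot _) hτ).2 ⟨(h u hu).2.1, (h u hu).2.2 x hx⟩⟩⟩

/-! ### Consequences of growth: displacement bounds, uniqueness, affine minorants. -/

namespace GrowthAt

variable {τ κ : ℝ} {u : StrongDual ℝ X} {S : Set X} {z : X}

/-- If `x` satisfies the minimality condition for `f - v` against `z`, then `‖x - z‖` is controlled
by `‖v - u‖`. -/
theorem gauge_le (hbot : ∀ x, f x ≠ ⊥) (hτ : 0 < τ) (h : GrowthAt φ τ κ f u S z)
    {v : StrongDual ℝ X} {x : X} (hx : x ∈ S) (hv : f x + ((v (z - x) : ℝ) : EReal) ≤ f z) :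
    φ (κ * ‖x - z‖) ≤ τ * (‖v - u‖ * ‖x - z‖) := by
  obtain ⟨-, hz, hg⟩ := h
  have hxt : f x ≠ ⊤ := by
    intro hx
    rw [hx, EReal.top_add_coe, top_le_iff] at hv
    exact hz hv
  obtain ⟨cz, hcz⟩ := exists_eq_coe hbot hz
  obtain ⟨cx, hcx⟩ := exists_eq_coe hbot hxt
  have h1 := hg x hx
  rw [hcz, hcx] at h1 hv
  norm_cast at h1 hv
  have h2 := apply_le_norm_mul (v - u) (x - z)
  simp only [sub_apply, map_sub] at h1 h2 hv
  rw [← div_le_iff₀' hτ]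
  linarith

theorem rate_le (hg : IsRate φ g) (hbot : ∀ x, f x ≠ ⊥) (hτ : 0 < τ) (hκ : 0 < κ)
    (h : GrowthAt φ τ κ f u S z) {v : StrongDual ℝ X} {x : X} (hx : x ∈ S)
    (hv : f x + ((v (z - x) : ℝ) : EReal) ≤ f z) :
    g (κ / 2 * ‖x - z‖) ≤ 2 * τ / κ * ‖v - u‖ :=
  hg.le_of_gauge_le hκ (norm_nonneg _) (norm_nonneg _) hτ.le (h.gauge_le hbot hτ hx hv)

theorem eq_of_le (hg : IsRate φ g) (hbot : ∀ x, f x ≠ ⊥) (hτ : 0 < τ) (hκ : 0 < κ)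
    (h : GrowthAt φ τ κ f u S z) {x : X} (hx : x ∈ S)
    (hv : f x + ((u (z - x) : ℝ) : EReal) ≤ f z) : x = z := by
  have := h.gauge_le hbot hτ hx hv
  rw [sub_self, norm_zero, zero_mul, mul_zero] at this
  by_contra hne
  exact absurd (hg.gauge_pos (mul_pos hκ (norm_pos_iff.2 (sub_ne_zero.2 hne)))) (not_lt.2 this)

theorem minorant (hg : IsRate φ g) (hτ : 0 < τ) (hκ : 0 < κ)
    (h : GrowthAt φ τ κ f u S z) {x : X} (hx : x ∈ S) :
    f z + ((u (x - z) : ℝ) : EReal) ≤ f x := by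
  refine le_trans ?_ (h.2.2 x hx)
  gcongr
  have : 0 ≤ φ (κ * ‖x - z‖) := by
    rcases (norm_nonneg (x - z)).eq_or_lt with h0 | h0
    · rw [← h0, mul_zero, hg.gauge_zero]
    · exact (hg.gauge_pos (by positivity)).le
  have : 0 ≤ φ (κ * ‖x - z‖) / τ := by positivity
  exact_mod_cast (by linarith : u (x - z) ≤ φ (κ * ‖x - z‖) / τ + u (x - z))

theorem argminOn_eq (hg : IsRate φ g) (hbot : ∀ x, f x ≠ ⊥) (hτ : 0 < τ) (hκ : 0 < κ)
    (h : GrowthAt φ τ κ f u S z) : argminOn (tilt f u) S = {z} := by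
  ext x
  rw [mem_argminOn_tilt_iff hbot, mem_singleton_iff]
  constructor
  · rintro ⟨hx, hmin⟩
    exact h.eq_of_le hg hbot hτ hκ hx (hmin z h.1)
  · rintro rfl
    exact ⟨h.1, fun y hy => h.minorant hg hτ hκ hy⟩

end GrowthAt

/-- The growth point is the only minimizer, so the distance to the argmin is the distance to that
point. -/
theorem SLWP.swlwp (hg : IsRate φ g) (hbot : ∀ x, f x ≠ ⊥) (h : SLWP φ f a) : SWLWP φ f a := by
  obtain ⟨δ, r, τ, κ, hδ, hr, hτ, hκ, m, hm, h⟩ := (slwp_iff hbot).1 h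
  refine ⟨r, r, δ, κ, τ, hr, hr, hδ, hκ, hτ, ?_, fun x hx u hu => ?_⟩
  · have := (h 0 (mem_ball_self hδ)).argminOn_eq hg hbot hτ hκ
    rw [tilt_zero, hm] at this
    rw [this]
    rfl
  · have hu' := (h u hu).argminOn_eq hg hbot hτ hκ
    have hmem : m u ∈ argminOn (tilt f u) (closedBall a r) := by rw [hu']; rfl
    refine ⟨⟨_, hmem⟩, ?_⟩
    rw [iInf_eq_of_mem_argminOn hmem, hu', infDist_singleton, dist_eq_norm]
    exact (coe_le_mul_tilt_sub_tilt_iff (hbot x) (hbot _) hτ).2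
      ⟨(h u hu).2.1, (h u hu).2.2 x (ball_subset_closedBall hx)⟩

/-- Growth of `f - u` at `x` and minimality of `x` for `f - v` are compared at a minimizer `z` with
`‖x - z‖ < 2 d`, since the distance `d` to the argmin need not be attained. -/
theorem SWLWP.weakTSLM (hg : IsRate φ g) (hbot : ∀ x, f x ≠ ⊥) (h : SWLWP φ f a) :
    WeakTSLM (invPos g) f a := by
  obtain ⟨r, γ, δ, τ, κ, hr, hγ, hδ, hτ, hκ, ha, h⟩ := h
  refine ⟨r, γ, 4 / τ, δ, 4 * κ / τ, hr, hγ, by positivity, hδ, by positivity, ha, ?_⟩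
  rintro v hv u hu x ⟨hx, hxγ⟩
  rcases eq_or_ne v u with rfl | hvu
  · exact ⟨x, hx, by simp⟩
  obtain ⟨hne, hgrow⟩ := h x hxγ u hu
  set A := argminOn (tilt f u) (closedBall a r)
  have key : ∀ t, 0 < t → (infDist x A < 4 / τ * t) → g t ≤ 4 * κ / τ * ‖v - u‖ →
      ∃ z ∈ A, ‖x - z‖ₑ ≤ ENNReal.ofReal (4 / τ) * invPos g (4 * κ / τ * ‖v - u‖) := by
    intro t ht hlt hgt
    obtain ⟨z, hz, hxz⟩ := (infDist_lt_iff hne).1 hlt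
    refine ⟨z, hz, ?_⟩
    calc ‖x - z‖ₑ = ENNReal.ofReal ‖x - z‖ := (ofReal_norm _).symm
      _ ≤ ENNReal.ofReal (4 / τ * t) := by
        rw [← dist_eq_norm]; exact ENNReal.ofReal_le_ofReal hxz.le
      _ = ENNReal.ofReal (4 / τ) * ENNReal.ofReal t := ENNReal.ofReal_mul (by positivity)
      _ ≤ _ := by gcongr; exact hg.ofReal_le_invPos ht.le hgt
  have hd0 : 0 ≤ infDist x A := infDist_nonneg
  rcases hd0.eq_or_lt with hd | hd
  -- At distance zero `x` may lie outside the argmin; `v ≠ u` leaves room for a positive `t`.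
  · obtain ⟨t, ht, hgt⟩ := hg.exists_pos_le
      (s := 4 * κ / τ * ‖v - u‖) (by have := norm_pos_iff.2 (sub_ne_zero.2 hvu); positivity)
    exact key t ht (by rw [← hd]; positivity) hgt
  · obtain ⟨z, hz, hxz⟩ := (infDist_lt_iff hne).1 (show infDist x A < 2 * infDist x A by linarith)
    rw [iInf_eq_of_mem_argminOn hz] at hgrow
    obtain ⟨hzt, h1⟩ := (coe_le_mul_tilt_sub_tilt_iff (hbot x) (hbot _) hκ).1 hgrow
    have hx' := (mem_argminOn_tilt_iff hbot).1 hx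
    have h2 := hx'.2 z hz.1
    have hxt := ne_top_of_mem_argminOn hbot hx hz.1 hzt
    obtain ⟨cz, hcz⟩ := exists_eq_coe hbot hzt
    obtain ⟨cx, hcx⟩ := exists_eq_coe hbot hxt
    rw [hcz, hcx] at h1 h2
    norm_cast at h1 h2
    have h3 := apply_le_norm_mul (v - u) (x - z)
    simp only [sub_apply, map_sub] at h1 h2 h3
    rw [dist_eq_norm] at hxz
    have h4 : ‖v - u‖ * ‖x - z‖ ≤ 2 * ‖v - u‖ * infDist x A := by
      nlinarith [norm_nonneg (v - u)]
    -- This `t` makes the allowed radius `4 / τ * t` equal to twice the distance.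
    refine key (τ / 2 * infDist x A) (by positivity) ?_ ?_
    · rw [show 4 / τ * (τ / 2 * infDist x A) = 2 * infDist x A by field_simp; ring]
      linarith
    · have := hg.le_of_gauge_le (κ := τ) (τ := κ) (c := 2 * ‖v - u‖) hτ hd.le (by positivity) hκ.le
        (by rw [← div_le_iff₀' hκ]; linarith)
      rw [show 4 * κ / τ * ‖v - u‖ = 2 * κ / τ * (2 * ‖v - u‖) by ring]
      exact this

/-- If `f - v` had two minimizers, tilting towards one of them would drive minimizers away from the
other, against the stability estimate. -/
theorem WeakTSLM.tslm (hg : IsRate φ g) (hbot : ∀ x, f x ≠ ⊥) (hfa : f a ≠ ⊤)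
    (h : WeakTSLM (invPos g) f a) : TSLM (invPos g) f a := by
  obtain ⟨r, γ, κ, δ, τ, hr, hγ, hκ, hδ, hτ, ha, h⟩ := h
  have hmove : ∀ v ∈ ball (0 : StrongDual ℝ X) δ, ∀ u ∈ ball (0 : StrongDual ℝ X) δ, ∀ t, 0 < t →
      τ * ‖v - u‖ ≤ g t → ∀ x ∈ argminOn (tilt f v) (closedBall a r) ∩ ball a γ,
      ∃ z ∈ argminOn (tilt f u) (closedBall a r), ‖x - z‖ ≤ κ * t := by
    intro v hv u hu t ht hgt x hx
    obtain ⟨z, hz, hxz⟩ := h v hv u hu hx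
    refine ⟨z, hz, ?_⟩
    have h1 := hxz.trans (mul_le_mul_right (hg.invPos_le_ofReal ht.le (by positivity) hgt) _)
    rw [← ENNReal.ofReal_mul hκ.le, ← ofReal_norm,
      ENNReal.ofReal_le_ofReal_iff (by positivity)] at h1
    exact h1
  have huniq : ∀ v ∈ ball (0 : StrongDual ℝ X) δ,
      ∀ x ∈ argminOn (tilt f v) (closedBall a r) ∩ ball a γ,
      ∀ x' ∈ argminOn (tilt f v) (closedBall a r), x' = x := by
    intro v hv x hx x' hx'
    by_contra hne
    have hd : 0 < ‖x' - x‖ := norm_pos_iff.2 (sub_ne_zero.2 hne)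
    obtain ⟨p, hp, hpx⟩ := exists_dual_vector ℝ (x' - x) hd.ne'
    rw [mem_ball_zero_iff] at hv
    -- With this `t` a minimizer `z` for the tilt `v + s • p` lies within half of `‖x' - x‖` from
    -- `x`.
    set t := ‖x' - x‖ / (2 * κ) with ht
    have ht0 : 0 < t := by positivity
    have hgt := hg.pos ht0
    set s := min (g t / τ) ((δ - ‖v‖) / 2) with hs
    have hs0 : 0 < s := lt_min (by positivity) (by linarith)
    have hs1 : τ * s ≤ g t := by
      rw [← le_div_iff₀' hτ]; exact min_le_left _ _
    have hs2 : s ≤ (δ - ‖v‖) / 2 := min_le_right _ _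
    have hsp : ‖s • p‖ = s := by rw [norm_smul, hp, mul_one, Real.norm_of_nonneg hs0.le]
    obtain ⟨z, hz, hxz⟩ := hmove v (mem_ball_zero_iff.2 hv) (v + s • p)
      (by rw [mem_ball_zero_iff]; linarith [norm_add_le v (s • p)]) t ht0
      (by rw [sub_add_cancel_left, norm_neg, hsp]; exact hs1) x hx
    have hzt := ne_top_of_mem_argminOn hbot hz (mem_closedBall_self hr.le) hfa
    have hxt := ne_top_of_mem_argminOn hbot hx' (mem_closedBall_self hr.le) hfa
    obtain ⟨cz, hcz⟩ := exists_eq_coe hbot hzt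
    obtain ⟨cx, hcx⟩ := exists_eq_coe hbot hxt
    have h1 := ((mem_argminOn_tilt_iff hbot).1 hz).2 x' hx'.1
    have h2 := ((mem_argminOn_tilt_iff hbot).1 hx').2 z hz.1
    rw [hcz, hcx] at h1 h2
    norm_cast at h1 h2
    have h3 := apply_le_norm_mul p (z - x)
    rw [hp, one_mul, norm_sub_rev] at h3
    have h4 : κ * t = ‖x' - x‖ / 2 := by rw [ht]; field_simp
    simp only [add_apply, smul_apply, map_sub,
      smul_eq_mul] at h1 h2 h3 hpx
    -- `p` norms `x' - x` and `z` is near `x`, so `p (x' - z) > 0`; adding `h1` and `h2` gives the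
    -- opposite sign.
    have h5 : 0 < s * (p x' - p z) := mul_pos hs0 (by
      simp only [RCLike.ofReal_real_eq_id, id] at hpx
      linarith)
    linarith
  -- Moved minimizers then stay in `ball a γ`, where uniqueness applies, and in the open ball of
  -- radius `r`.
  set t₀ := min γ r / (2 * κ) with ht₀
  have hmin : 0 < min γ r := lt_min hγ hr
  have ht₀' : 0 < t₀ := by positivity
  have hκt : κ * t₀ < min γ r := by
    rw [show κ * t₀ = min γ r / 2 by rw [ht₀]; field_simp]; linarith
  have hgt := hg.pos ht₀'
  have hex : ∀ u ∈ ball (0 : StrongDual ℝ X) (min δ (g t₀ / τ)),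
      ∃ z ∈ argminOn (tilt f u) (closedBall a r), dist z a < min γ r := by
    intro u hu
    rw [mem_ball_zero_iff, lt_min_iff, lt_div_iff₀' hτ] at hu
    obtain ⟨z, hz, haz⟩ := hmove 0 (mem_ball_self hδ) u (mem_ball_zero_iff.2 hu.1) t₀ ht₀'
      (by rw [zero_sub, norm_neg]; exact hu.2.le) a ⟨by rwa [tilt_zero], mem_ball_self hγ⟩
    exact ⟨z, hz, by rw [dist_comm, dist_eq_norm]; exact haz.trans_lt hκt⟩
  have : Nonempty X := ⟨a⟩
  choose! M hM hMd using hex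
  have hδ' : 0 < min δ (g t₀ / τ) := lt_min hδ (by positivity)
  have hsub : ball (0 : StrongDual ℝ X) (min δ (g t₀ / τ)) ⊆ ball 0 δ :=
    ball_subset_ball (min_le_left _ _)
  have hMγ : ∀ u ∈ ball (0 : StrongDual ℝ X) (min δ (g t₀ / τ)),
      M u ∈ argminOn (tilt f u) (closedBall a r) ∩ ball a γ := fun u hu =>
    ⟨hM u hu, (hMd u hu).trans_le (min_le_left _ _)⟩
  refine ⟨min δ (g t₀ / τ), r, 1 / κ, τ, hδ', hr, by positivity, hτ, M, ?_, fun u hu => ⟨(hM u hu).1,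
    ?_, ?_⟩, fun u hu v hv => ?_⟩
  · exact (huniq 0 (mem_ball_self hδ) (M 0) (hMγ 0 (mem_ball_self hδ')) a
      (by rwa [tilt_zero])).symm
  · exact (hMd u hu).trans_le (min_le_right _ _)
  · exact fun z hz => (hM u hu).2 z (ball_subset_closedBall hz)
  · obtain ⟨z, hz, hle⟩ := h u (hsub hu) v (hsub hv) (hMγ u hu)
    rw [huniq v (hsub hv) _ (hMγ v hv) z hz] at hle
    calc ENNReal.ofReal (1 / κ) * ‖M u - M v‖ₑ
        ≤ ENNReal.ofReal (1 / κ) * (ENNReal.ofReal κ * invPos g (τ * ‖u - v‖)) := by gcongr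
      _ = invPos g (τ * ‖u - v‖) := by
        rw [← mul_assoc, ← ENNReal.ofReal_mul (by positivity), one_div_mul_cancel hκ.ne',
          ENNReal.ofReal_one, one_mul]

/-- Minimality of `M (v + s • p)` against `x` and of `M v` against `M (v + s • p)` sum to an excess
of at least `s * p (x - M (v + s • p))` at `x`. -/
theorem TSLM.slwp (hg : IsRate φ g) (hbot : ∀ x, f x ≠ ⊥) (hfa : f a ≠ ⊤)
    (h : TSLM (invPos g) f a) : SLWP φ f a := by
  obtain ⟨δ, r, κ, τ, hδ, hr, hκ, hτ, M, hM0, hM, hψ⟩ := h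
  have hmove : ∀ u ∈ ball (0 : StrongDual ℝ X) δ, ∀ v ∈ ball (0 : StrongDual ℝ X) δ, ∀ t, 0 ≤ t →
      τ * ‖u - v‖ ≤ g t → κ * ‖M u - M v‖ ≤ t := by
    intro u hu v hv t ht hgt
    exact (ofReal_mul_enorm_le_iff hκ.le ht).1
      ((hψ u hu v hv).trans (hg.invPos_le_ofReal ht (by positivity) hgt))
  obtain ⟨t₀, ht₀, hgt₀⟩ := hg.exists_pos_le (s := τ * (δ / 2)) (by positivity)
  -- Since `d ≤ 2 r'`, the first bound keeps the extra tilt below `δ / 2`; the second places `x` in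
  -- the open ball.
  set r' := min (t₀ / κ) (r / 2) with hr'
  have hr'0 : 0 < r' := lt_min (by positivity) (by positivity)
  have hr'1 : κ * r' ≤ t₀ := by rw [← le_div_iff₀' hκ]; exact min_le_left _ _
  have hr'2 : r' < r := (min_le_right _ _).trans_lt (by linarith)
  have hgr := hg.pos (mul_pos hκ hr'0)
  refine (slwp_iff hbot).2 ⟨min (δ / 2) (g (κ * r') / τ), r', κ * τ, κ / 2,
    lt_min (by positivity) (by positivity), hr'0, by positivity, by positivity, M, hM0, ?_⟩
  intro v hv
  rw [mem_ball_zero_iff, lt_min_iff, lt_div_iff₀' hτ] at hv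
  have hvδ : v ∈ ball (0 : StrongDual ℝ X) δ := by rw [mem_ball_zero_iff]; linarith
  have hMv : M v ∈ closedBall a r' := by
    have := hmove v hvδ 0 (mem_ball_self hδ) (κ * r') (by positivity)
      (by rw [sub_zero]; exact hv.2.le)
    rw [hM0] at this
    rw [mem_closedBall, dist_eq_norm]
    exact le_of_mul_le_mul_left this hκ
  have hfin : ∀ u ∈ ball (0 : StrongDual ℝ X) δ, f (M u) ≠ ⊤ := fun u hu =>
    ne_top_of_mem_argminOn hbot (hM u hu).2 (mem_ball_self hr) hfa
  refine ⟨hMv, hfin v hvδ, fun x hx => ?_⟩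
  rcases eq_or_ne x (M v) with rfl | hne
  · simp [hg.gauge_zero]
  have hd : 0 < ‖x - M v‖ := norm_pos_iff.2 (sub_ne_zero.2 hne)
  set d := ‖x - M v‖ with hd'
  have hdr : d ≤ 2 * r' := by
    rw [hd', ← dist_eq_norm]
    linarith [dist_triangle_right x (M v) a, mem_closedBall.1 hx, mem_closedBall.1 hMv]
  obtain ⟨p, hp, hpx⟩ := exists_dual_vector ℝ (x - M v) hd.ne'
  simp only [RCLike.ofReal_real_eq_id, id] at hpx
  have hgd := hg.pos (show 0 < κ * d / 2 by positivity)
  -- The strength for which stability moves the minimizer by at most `d / 2`.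
  set s := g (κ * d / 2) / τ with hs
  have hs0 : 0 < s := by positivity
  have hs1 : s ≤ δ / 2 := by
    rw [hs, div_le_iff₀' hτ]
    refine (hg.mono (by positivity) ?_).trans hgt₀
    nlinarith
  have hsp : ‖s • p‖ = s := by rw [norm_smul, hp, mul_one, Real.norm_of_nonneg hs0.le]
  have huδ : v + s • p ∈ ball (0 : StrongDual ℝ X) δ := by
    rw [mem_ball_zero_iff]; linarith [norm_add_le v (s • p)]
  have hdist : κ * ‖M (v + s • p) - M v‖ ≤ κ * d / 2 :=
    hmove _ huδ v hvδ _ (by positivity)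
      (by rw [add_sub_cancel_left, hsp, hs, mul_div_cancel₀ _ hτ.ne'])
  have h1 := ((mem_argminOn_tilt_iff hbot).1 (hM _ huδ).2).2 x
    (mem_ball.2 ((mem_closedBall.1 hx).trans_lt hr'2))
  have h2 := ((mem_argminOn_tilt_iff hbot).1 (hM v hvδ).2).2 (M (v + s • p)) (hM _ huδ).2.1
  obtain ⟨cu, hcu⟩ := exists_eq_coe hbot (hfin _ huδ)
  obtain ⟨cv, hcv⟩ := exists_eq_coe hbot (hfin v hvδ)
  rw [hcu] at h1 h2
  rw [hcv] at h2 ⊢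
  refine le_trans ?_ h1
  norm_cast at h2 ⊢
  have h3 := apply_le_norm_mul p (M (v + s • p) - M v)
  rw [hp, one_mul] at h3
  have h4 : ‖M (v + s • p) - M v‖ ≤ d / 2 := by
    refine le_of_mul_le_mul_left ?_ hκ
    linarith
  have h5 := hg.le_mul (κ / 2 * d) (by positivity)
  have h6 : φ (κ / 2 * d) / (κ * τ) ≤ s * (d / 2) := by
    rw [div_le_iff₀ (by positivity)]
    refine h5.trans_eq ?_
    rw [hs, show κ / 2 * d = κ * d / 2 by ring]
    field_simp
  simp only [add_apply, smul_apply, map_sub,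
    smul_eq_mul] at h2 h3 hpx ⊢
  have h7 : s * (d / 2) ≤ s * (p x - p (M (v + s • p))) :=
    mul_le_mul_of_nonneg_left (by linarith) hs0.le
  linarith

end Growth

/-! ### The Clarke–Rockafellar subdifferential -/

/-- A basis description of the filter of `f`-attentive convergence. -/
theorem eventually_attentive_iff {X : Type*} [NormedAddCommGroup X] {f : X → EReal}
    {x : X} {c₀ : ℝ} (hx : f x = c₀) {P : X × ℝ → Prop} :
    (∀ᶠ p in (𝓝 x ⊓ comap f (𝓝 (f x))) ×ˢ 𝓝[>] (0 : ℝ), P p) ↔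
      ∃ η, 0 < η ∧ ∀ (y : X) (c t : ℝ), f y = c → dist y x < η → |c - c₀| < η → 0 < t → t < η →
        P (y, t) := by
  have hbasis : (𝓝 (c₀ : EReal)).HasBasis (fun ε : ℝ => 0 < ε)
      (fun ε => Real.toEReal '' ball c₀ ε) := by
    rw [EReal.nhds_coe]
    exact nhds_basis_ball.map _
  have hb := ((nhds_basis_ball (x := x)).inf (hbasis.comap f)).prod
    (nhdsGT_basis (0 : ℝ))
  rw [hx, hb.eventually_iff]
  constructor
  · rintro ⟨⟨⟨i, j⟩, k⟩, ⟨⟨hi, hj⟩, hk⟩, H⟩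
    refine ⟨min i (min j k), lt_min hi (lt_min hj hk), fun y c t hy h1 h2 h3 h4 => H ?_⟩
    simp only [lt_min_iff] at h1 h2 h4
    exact ⟨⟨h1.1, c, by rw [mem_ball, Real.dist_eq]; exact h2.2.1, hy.symm⟩, h3, h4.2.2⟩
  · rintro ⟨η, hη, H⟩
    refine ⟨⟨⟨η, η⟩, η⟩, ⟨⟨hη, hη⟩, hη⟩, ?_⟩
    rintro ⟨y, t⟩ ⟨⟨h1, c, hc, hy⟩, h3, h4⟩
    rw [mem_ball, Real.dist_eq] at hc
    exact H y c t hy.symm h1 hc h3 h4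

section Subdifferential

variable {X : Type*} [NormedAddCommGroup X] [NormedSpace ℝ X] {f : X → EReal}

/-- `α` bounds the generalized directional derivative of `f` at `x` in the direction `h`, in the
quantified form that corresponds to the epigraphical (Clarke) tangent cone. -/
def UpBound (f : X → EReal) (x h : X) (α : ℝ) : Prop :=
  ∀ ε, 0 < ε → ∃ η, 0 < η ∧ ∀ (y : X) (c t : ℝ), f y = c → dist y x < η →
    |c - (f x).toReal| < η → 0 < t → t < η →
      ∃ w ∈ closedBall h ε, f (y + t • w) ≤ ((c + t * α : ℝ) : EReal)

theorem sub_div_le_coe_iff {p : EReal} {c t α : ℝ} (ht : 0 < t) :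
    (p - (c : EReal)) / (t : EReal) ≤ (α : EReal) ↔ p ≤ ((c + t * α : ℝ) : EReal) := by
  rw [EReal.div_le_iff_le_mul (by exact_mod_cast ht) (EReal.coe_ne_top t)]
  induction p with
  | bot => simp
  | top =>
    rw [EReal.top_sub_coe, ← EReal.coe_mul]
    simp [-EReal.coe_mul, -EReal.coe_add]
  | coe p =>
    norm_cast
    rw [sub_le_iff_le_add']

theorem upDeriv_le_of_upBound {x h : X} {α c₀ : ℝ} (hx : f x = c₀) (hα : UpBound f x h α) :
    upDeriv f x h ≤ α := by
  refine iSup₂_le fun ε hε => limsup_le_of_le (h := (eventually_attentive_iff hx).2 ?_)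
  obtain ⟨η, hη, H⟩ := hα ε hε
  refine ⟨η, hη, fun y c t hy h1 h2 h3 h4 => ?_⟩
  obtain ⟨w, hw, hle⟩ := H y c t hy h1 (by rwa [hx, EReal.toReal_coe]) h3 h4
  refine (iInf₂_le w hw).trans ?_
  rw [hy]
  exact (sub_div_le_coe_iff h3).2 hle

theorem upBound_of_upDeriv_lt {x h : X} {α c₀ : ℝ} (hx : f x = c₀) (hα : upDeriv f x h < α) :
    UpBound f x h α := by
  intro ε hε
  have h1 := (le_iSup₂ (f := fun (ε : ℝ) (_ : 0 < ε) => limsup (fun p : X × ℝ =>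
        ⨅ w ∈ closedBall h ε, (f (p.1 + p.2 • w) - f p.1) / (p.2 : EReal))
      ((𝓝 x ⊓ comap f (𝓝 (f x))) ×ˢ 𝓝[>] (0 : ℝ))) ε hε).trans_lt hα
  obtain ⟨η, hη, H⟩ := (eventually_attentive_iff hx).1 (eventually_lt_of_limsup_lt h1)
  refine ⟨η, hη, fun y c t hy h1 h2 h3 h4 => ?_⟩
  rw [hx, EReal.toReal_coe] at h2
  have := H y c t hy h1 h2 h3 h4
  simp only [iInf_lt_iff] at this
  obtain ⟨w, hw, hlt⟩ := this
  rw [hy] at hlt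
  exact ⟨w, hw, (sub_div_le_coe_iff h3).1 hlt.le⟩

/-- `f^↑` is determined by the reals strictly above it, all of which are upper bounds in the
quantified sense; no limsup or infinite value has to be handled afterwards. -/
theorem mem_subdiff_iff (hbot : ∀ x, f x ≠ ⊥) {x : X} {u : StrongDual ℝ X} :
    u ∈ subdiff f x ↔ f x ≠ ⊤ ∧ ∀ h α, UpBound f x h α → u h ≤ α := by
  refine and_congr_right fun hx => ?_
  obtain ⟨c₀, hc₀⟩ := exists_eq_coe hbot hx
  constructor
  · intro H h α hα
    exact_mod_cast (H h).trans (upDeriv_le_of_upBound hc₀ hα)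
  · intro H h
    refine EReal.le_of_forall_lt_iff_le.1 fun α hα => ?_
    exact_mod_cast H h α (upBound_of_upDeriv_lt hc₀ hα)

/-! ### Calculus of upper bounds for `f^↑`. -/

namespace UpBound

variable {x h h₁ h₂ : X} {α α₁ α₂ : ℝ}

theorem zero (f : X → EReal) (x : X) : UpBound f x 0 0 := by
  intro ε hε
  refine ⟨1, one_pos, fun y c t hy _ _ _ _ => ⟨0, mem_closedBall_self hε.le, ?_⟩⟩
  simp [hy]

theorem smul (hα : UpBound f x h α) {c : ℝ} (hc : 0 < c) : UpBound f x (c • h) (c * α) := by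
  intro ε hε
  obtain ⟨η, hη, H⟩ := hα (ε / c) (by positivity)
  refine ⟨min η (η / c), lt_min hη (by positivity), fun y b t hy h1 h2 h3 h4 => ?_⟩
  rw [lt_min_iff] at h1 h2 h4
  obtain ⟨w, hw, hle⟩ := H y b (t * c) hy h1.1 h2.1 (by positivity) ((lt_div_iff₀ hc).1 h4.2)
  refine ⟨c • w, ?_, by rwa [smul_smul, ← mul_assoc]⟩
  rw [mem_closedBall, dist_smul₀, Real.norm_of_nonneg hc.le, ← le_div_iff₀' hc]
  exact hw

/-- Rockafellar's theorem: the generalized directional derivative is subadditive. -/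
theorem add (hbot : ∀ x, f x ≠ ⊥) (hlsc : LowerSemicontinuous f) {c₀ : ℝ} (hx : f x = c₀)
    (hα₁ : UpBound f x h₁ α₁) (hα₂ : UpBound f x h₂ α₂) :
    UpBound f x (h₁ + h₂) (α₁ + α₂) := by
  intro ε hε
  obtain ⟨η₂, hη₂, H₂⟩ := hα₂ (ε / 2) (by positivity)
  obtain ⟨η₁, hη₁, H₁⟩ := hα₁ (ε / 2) (by positivity)
  -- Lower semicontinuity bounds the value at `y + t • w₁` from below and `hle₁` from above, so that
  -- point is attentively close to `x` and the second bound applies there.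
  have hl := hlsc x ((c₀ - η₂ : ℝ) : EReal) (by
    change ((c₀ - η₂ : ℝ) : EReal) < f x
    rw [hx]
    exact_mod_cast (by linarith))
  obtain ⟨η₃, hη₃, H₃⟩ := Metric.eventually_nhds_iff.1 hl
  set K := min η₂ η₃ with hK
  have hK0 : 0 < K := lt_min hη₂ hη₃
  -- `B` dominates both the step `‖w₁‖` and the rate `α₁`.
  set B := ‖h₁‖ + ε + |α₁| + 1 with hB
  have hB1 : 1 ≤ B := by
    have := norm_nonneg h₁
    have := abs_nonneg α₁
    linarith
  refine ⟨min η₁ (K / (2 * B)), lt_min hη₁ (by positivity), fun y c t hy h1 h2 h3 h4 => ?_⟩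
  rw [lt_min_iff] at h1 h2 h4
  obtain ⟨w₁, hw₁, hle₁⟩ := H₁ y c t hy h1.1 h2.1 h3 h4.1
  have hKB : K / (2 * B) * B = K / 2 := by field_simp
  have hKB' : K / (2 * B) ≤ K / 2 := by
    rw [← hKB]; exact le_mul_of_one_le_right (by positivity) hB1
  have htB : t * B < K / 2 := by
    rw [← hKB]; exact mul_lt_mul_of_pos_right h4.2 (by linarith)
  have hw₁n : ‖w₁‖ ≤ B := by
    have h5 : ‖w₁‖ ≤ ‖w₁ - h₁‖ + ‖h₁‖ := by
      simpa using norm_add_le (w₁ - h₁) h₁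
    have h6 := mem_closedBall.1 hw₁
    rw [dist_eq_norm] at h6
    linarith [abs_nonneg α₁]
  have hdist : dist (y + t • w₁) x < K := by
    have h5 : dist (y + t • w₁) x ≤ dist y x + ‖t • w₁‖ := by
      rw [dist_eq_norm, dist_eq_norm, add_sub_right_comm]; exact norm_add_le _ _
    rw [norm_smul, Real.norm_of_nonneg h3.le] at h5
    have h6 : t * ‖w₁‖ ≤ t * B := by gcongr
    linarith [h1.2]
  have htop : f (y + t • w₁) ≠ ⊤ := ne_top_of_le_ne_top (EReal.coe_ne_top _) hle₁
  obtain ⟨c₁, hc₁⟩ := exists_eq_coe hbot htop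
  have hlow : ((c₀ - η₂ : ℝ) : EReal) < f (y + t • w₁) := H₃ (hdist.trans_le (min_le_right _ _))
  rw [hc₁] at hlow hle₁
  norm_cast at hlow hle₁
  have hα₁B : t * α₁ ≤ t * B :=
    mul_le_mul_of_nonneg_left (by linarith [le_abs_self α₁, norm_nonneg h₁]) h3.le
  rw [hx, EReal.toReal_coe] at h2
  have hKη : K ≤ η₂ := min_le_left _ _
  obtain ⟨w₂, hw₂, hle₂⟩ := H₂ (y + t • w₁) c₁ t hc₁ (hdist.trans_le hKη)
    (by
      rw [hx, EReal.toReal_coe, abs_lt]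
      have := (abs_lt.1 h2.2).2
      constructor <;> linarith) h3
    (by nlinarith)
  refine ⟨w₁ + w₂, ?_, ?_⟩
  · rw [mem_closedBall] at hw₁ hw₂ ⊢
    exact (dist_add_add_le _ _ _ _).trans (by linarith)
  · rw [smul_add, ← add_assoc]
    refine hle₂.trans ?_
    exact_mod_cast (by linarith : c₁ + t * α₂ ≤ c + t * (α₁ + α₂))

/-- An approximate minorant bounds the generalized directional derivative from below. -/
theorem ge_of_minorant (hbot : ∀ x, f x ≠ ⊥) (hx : f x ≠ ⊤) {u : StrongDual ℝ X} {l ρ : ℝ}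
    (hl : 0 ≤ l) (hρ : 0 < ρ)
    (hmin : ∀ y ∈ ball x ρ, f x + ((u (y - x) - l * ‖y - x‖ : ℝ) : EReal) ≤ f y)
    (hα : UpBound f x h α) : u h - l * ‖h‖ ≤ α := by
  obtain ⟨c₀, hc₀⟩ := exists_eq_coe hbot hx
  have key : ∀ ε, 0 < ε → u h - l * ‖h‖ ≤ α + (‖u‖ + l) * ε := by
    intro ε hε
    obtain ⟨η, hη, H⟩ := hα ε hε
    set t := min (η / 2) (ρ / (2 * (‖h‖ + ε))) with ht
    have hhε : 0 < ‖h‖ + ε := by positivity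
    have ht0 : 0 < t := lt_min (by positivity) (by positivity)
    obtain ⟨w, hw, hle⟩ := H x c₀ t hc₀ (by rwa [dist_self]) (by simp [hc₀, hη]) ht0
      ((min_le_left _ _).trans_lt (by linarith))
    rw [mem_closedBall, dist_eq_norm] at hw
    have hwn : ‖w‖ ≤ ‖h‖ + ε := by
      have h5 : ‖w‖ ≤ ‖w - h‖ + ‖h‖ := by simpa using norm_add_le (w - h) h
      linarith
    have htw : ‖t • w‖ < ρ := by
      rw [norm_smul, Real.norm_of_nonneg ht0.le]
      calc t * ‖w‖ ≤ ρ / (2 * (‖h‖ + ε)) * (‖h‖ + ε) := by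
            gcongr
            exact min_le_right _ _
        _ = ρ / 2 := by field_simp
        _ < ρ := by linarith
    have h1 := (hmin (x + t • w) (by rw [mem_ball, dist_eq_norm, add_sub_cancel_left]; exact htw)
      ).trans hle
    rw [hc₀, add_sub_cancel_left] at h1
    norm_cast at h1
    rw [map_smul, norm_smul, Real.norm_of_nonneg ht0.le, smul_eq_mul] at h1
    have h2 : u w - l * ‖w‖ ≤ α := le_of_mul_le_mul_left (by linarith) ht0
    have h3 := apply_le_norm_mul u (h - w)
    rw [norm_sub_rev, map_sub] at h3
    have h4 : ‖u‖ * ‖w - h‖ ≤ ‖u‖ * ε := by gcongr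
    have h5 : l * ‖w‖ ≤ l * (‖h‖ + ε) := by gcongr
    linarith
  have hlim : Tendsto (fun ε : ℝ => α + (‖u‖ + l) * ε) (𝓝[>] 0) (𝓝 α) := by
    have : Tendsto (fun ε : ℝ => α + (‖u‖ + l) * ε) (𝓝 0) (𝓝 (α + (‖u‖ + l) * 0)) :=
      (tendsto_id.const_mul _).const_add _
    rw [mul_zero, add_zero] at this
    exact this.mono_left nhdsWithin_le_nhds
  exact ge_of_tendsto hlim (eventually_nhdsWithin_of_forall fun ε hε => key ε hε)

end UpBound

/-- The sum rule at a local minimizer of `f - u + l ‖· - x‖`. -/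
theorem exists_mem_subdiff_of_minorant (hbot : ∀ x, f x ≠ ⊥) (hlsc : LowerSemicontinuous f) {x : X}
    (hx : f x ≠ ⊤) {u : StrongDual ℝ X} {l ρ : ℝ} (hl : 0 ≤ l) (hρ : 0 < ρ)
    (hmin : ∀ y ∈ ball x ρ, f x + ((u (y - x) - l * ‖y - x‖ : ℝ) : EReal) ≤ f y) :
    ∃ v ∈ subdiff f x, ‖v - u‖ ≤ l := by
  obtain ⟨c₀, hc₀⟩ := exists_eq_coe hbot hx
  -- `sInf (A h)` is the infimal convolution of `f^↑ - u` with `l‖·‖`; the minorant keeps it above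
  -- `-l‖h‖`.
  let A : X → Set ℝ := fun h => {s | ∃ k α, UpBound f x k α ∧ α - u k + l * ‖h - k‖ ≤ s}
  have hAbdd : ∀ h, ∀ s ∈ A h, -(l * ‖h‖) ≤ s := by
    rintro h s ⟨k, α, hα, hs⟩
    have h1 := hα.ge_of_minorant hbot hx hl hρ hmin
    have h2 : ‖k‖ ≤ ‖h‖ + ‖h - k‖ := by
      simpa using norm_sub_le h (h - k)
    have h3 := mul_le_mul_of_nonneg_left h2 hl
    linarith
  have hAbelow : ∀ h, BddBelow (A h) := fun h => ⟨_, hAbdd h⟩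
  have hAmem : ∀ {h k α}, UpBound f x k α → α - u k + l * ‖h - k‖ ∈ A h := fun hα =>
    ⟨_, _, hα, le_rfl⟩
  have hAne : ∀ h, (A h).Nonempty := fun h => ⟨_, hAmem (UpBound.zero f x)⟩
  have hsmul : ∀ c : ℝ, 0 < c → ∀ h, sInf (A (c • h)) ≤ c * sInf (A h) := by
    intro c hc h
    rw [← div_le_iff₀' hc]
    refine le_csInf (hAne h) ?_
    rintro s ⟨k, α, hα, hs⟩
    rw [div_le_iff₀' hc]
    refine csInf_le (hAbelow _) ⟨c • k, c * α, hα.smul hc, ?_⟩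
    rw [← smul_sub, norm_smul, Real.norm_of_nonneg hc.le, map_smul, smul_eq_mul]
    nlinarith
  -- Hahn–Banach from the zero subspace. Taking `k = 0` in the convolution gives `L ≤ l‖·‖`; taking
  -- `k = h` puts `u + L` in the subdifferential.
  obtain ⟨L, -, hL⟩ := exists_extension_of_le_sublinear (⊥ : X →ₗ.[ℝ] ℝ) (fun h => sInf (A h))
    (by
      intro c hc h
      refine le_antisymm (hsmul c hc h) ?_
      have := hsmul c⁻¹ (inv_pos.2 hc) (c • h)
      rw [inv_smul_smul₀ hc.ne', ← div_eq_inv_mul, le_div_iff₀' hc] at this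
      exact this)
    (by
      intro h k
      rw [← sub_le_iff_le_add]
      refine le_csInf (hAne h) ?_
      rintro s ⟨k₂, α₂, hα₂, hs₂⟩
      rw [sub_le_comm]
      refine le_csInf (hAne k) ?_
      rintro s' ⟨k₁, α₁, hα₁, hs₁⟩
      rw [sub_le_iff_le_add]
      refine csInf_le (hAbelow _) ⟨k₂ + k₁, α₂ + α₁, hα₂.add hbot hlsc hc₀ hα₁, ?_⟩
      have h1 : ‖h + k - (k₂ + k₁)‖ ≤ ‖h - k₂‖ + ‖k - k₁‖ := by
        rw [add_sub_add_comm]; exact norm_add_le _ _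
      have h2 := mul_le_mul_of_nonneg_left h1 hl
      rw [map_add]
      linarith)
    (by
      intro h
      obtain rfl : h = 0 := Subtype.ext ((Submodule.mem_bot ℝ).1 h.2)
      rw [LinearPMap.map_zero]
      refine le_csInf (hAne 0) fun s hs => ?_
      have := hAbdd 0 s hs
      simpa using this)
  have hLl : ∀ h, L h ≤ l * ‖h‖ := fun h => by
    refine (hL h).trans ((csInf_le (hAbelow h) (hAmem (UpBound.zero f x))).trans_eq ?_)
    simp
  have hLn : ∀ h, ‖L h‖ ≤ l * ‖h‖ := fun h => by
    rw [Real.norm_eq_abs, abs_le]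
    have := hLl (-h)
    rw [map_neg, norm_neg] at this
    exact ⟨by linarith, hLl h⟩
  refine ⟨u + L.mkContinuous l hLn, (mem_subdiff_iff hbot).2 ⟨hx, fun k α hα => ?_⟩, ?_⟩
  · have := (hL k).trans (csInf_le (hAbelow k) (hAmem hα))
    rw [sub_self, norm_zero, mul_zero, add_zero] at this
    simp only [add_apply, LinearMap.mkContinuous_apply]
    linarith
  · rw [add_sub_cancel_left]
    exact L.mkContinuous_norm_le hl hLn

/-- For convex functions the Clarke–Rockafellar subdifferential is the convex subdifferential. -/
theorem ConvexFun.mem_subdiff_iff (hf : ConvexFun f) (hbot : ∀ x, f x ≠ ⊥) {x : X}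
    {u : StrongDual ℝ X} :
    u ∈ subdiff f x ↔ f x ≠ ⊤ ∧ ∀ y, f x + ((u (y - x) : ℝ) : EReal) ≤ f y := by
  rw [TiltStability.mem_subdiff_iff hbot]
  refine and_congr_right fun hx => ?_
  obtain ⟨cx, hcx⟩ := exists_eq_coe hbot hx
  constructor
  · intro H y
    by_cases hy : f y = ⊤
    · simp [hy]
    obtain ⟨cy, hcy⟩ := exists_eq_coe hbot hy
    rw [hcx, hcy]
    suffices u (y - x) ≤ cy - cx by exact_mod_cast (by linarith : cx + u (y - x) ≤ cy)
    refine le_of_forall_pos_le_add fun e he => H _ _ fun ε hε => ?_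
    refine ⟨min ε (min e 1), by positivity, fun z c t hz h1 h2 h3 h4 => ?_⟩
    simp only [lt_min_iff] at h1 h2 h4
    -- Aiming from the base point `z` at `y` itself lets convexity apply on the segment; `e` absorbs
    -- the change of `f` from `x` to `z`.
    refine ⟨y - z, ?_, ?_⟩
    · rw [mem_closedBall, dist_sub_left]
      exact h1.1.le
    · have h5 := hf z y (1 - t) t (by linarith) h3 (by ring)
      rw [hz, hcy] at h5
      rw [show z + t • (y - z) = (1 - t) • z + t • y by module]
      refine h5.trans ?_
      rw [hcx, EReal.toReal_coe] at h2
      have h6 := (abs_lt.1 h2.2.1).1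
      norm_cast
      nlinarith
  · intro H h α hα
    have := hα.ge_of_minorant (u := u) hbot hx le_rfl one_pos (fun y _ => by simpa using H y)
    simpa using this

end Subdifferential

/-! ### Metric regularity of the subdifferential -/

section MetricRegularity

variable {X : Type*} [NormedAddCommGroup X] [NormedSpace ℝ X] {φ g : ℝ → ℝ} {f : X → EReal}
  {a : X}

/-- `t * g t` is monotone and `φ (2 * s)` dominates it at `s`; this turns a small excess into
closeness. -/
theorem IsRate.lt_of_gauge_lt (h : IsRate φ g) {s t : ℝ} (ht : 0 ≤ t) (hs : 0 ≤ s)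
    (hlt : φ (2 * s) < t * g t) : s < t := by
  by_contra! hts
  have h1 := h.mul_le s hs
  have h2 : t * g t ≤ s * g s := mul_le_mul hts (h.mono ht hts) (h.nonneg ht) hs
  linarith

theorem lowerSemicontinuous_tilt (hlsc : LowerSemicontinuous f) (u : StrongDual ℝ X) :
    LowerSemicontinuous (tilt f u) := by
  have hc : Continuous fun x => ((-(u x) : ℝ) : EReal) :=
    continuous_coe_real_ereal.comp u.continuous.neg
  have := hlsc.add' hc.lowerSemicontinuous fun x => EReal.continuousAt_add
    (Or.inr (EReal.coe_ne_bot _)) (Or.inr (EReal.coe_ne_top _))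
  have he : tilt f u = fun x => f x + ((-(u x) : ℝ) : EReal) := by
    ext x
    rw [tilt, sub_eq_add_neg, EReal.coe_neg]
  rw [he]
  exact this

theorem coe_le_tilt_iff {u : StrongDual ℝ X} {x : X} {m : ℝ} :
    (m : EReal) ≤ tilt f u x ↔ ((m + u x : ℝ) : EReal) ≤ f x := by
  unfold tilt
  rw [EReal.coe_add, EReal.le_sub_iff_add_le (Or.inl (EReal.coe_ne_bot _))
    (Or.inl (EReal.coe_ne_top _))]

theorem tilt_eq_coe {u : StrongDual ℝ X} {x : X} {c : ℝ} (hc : f x = c) :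
    tilt f u x = ((c - u x : ℝ) : EReal) := by
  rw [tilt, hc, EReal.coe_sub]

/-- Metric regularity of the subdifferential implies growth away from the critical set. -/
theorem RegIneq.gauge_le [CompleteSpace X] (hg : IsRate φ g) (hbot : ∀ x, f x ≠ ⊥)
    (hlsc : LowerSemicontinuous f) {r τ κ : ℝ} (hτ : 0 < τ) (hκ : 0 < κ)
    (hreg : RegIneq g (subdiff f) a 0 r τ κ) {R m c D : ℝ} {u : StrongDual ℝ X} {x : X}
    (hm : ∀ y ∈ closedBall a R, ((m + u y : ℝ) : EReal) ≤ f y) (hu : ‖u‖ < r) (hD : 0 < D)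
    (hDS : ∀ y ∈ invMulti (subdiff f) u, D ≤ dist x y) (hxr : dist x a + D / 2 < r)
    (hxR : dist x a + D / 2 < R) (hc : f x = c) :
    φ (τ / 2 * D) ≤ τ * κ * (c - u x - m) := by
  have hxmem : x ∈ closedBall a R := by rw [mem_closedBall]; linarith
  have h0 : m + u x ≤ c := by
    have := hm x hxmem
    rw [hc] at this
    exact_mod_cast this
  rw [← div_le_iff₀' (by positivity)]
  -- Working with `e` strictly above the excess makes Ekeland's slope `2 * e / D` positive and the
  -- displacement strictly less than `D / 2`.
  refine le_of_forall_gt_imp_ge_of_dense fun e he => ?_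
  have he0 : 0 < e := by linarith
  rw [div_le_iff₀' (by positivity)]
  have : CompleteSpace (closedBall a R) := isClosed_closedBall.completeSpace_coe
  obtain ⟨⟨x', hx'mem⟩, hx', hmin⟩ := ekeland (F := fun y : closedBall a R => tilt f u y)
    ((lowerSemicontinuous_tilt hlsc u).comp continuous_subtype_val) (m := m)
    (fun y => coe_le_tilt_iff.2 (hm y y.2)) (l := 2 * e / D) (by positivity) (x₀ := ⟨x, hxmem⟩)
    (by simp only [tilt_eq_coe hc]; exact EReal.coe_ne_top _)
  have hle := coe_le_tilt_iff.2 (hm x' hx'mem)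
  simp only [Subtype.dist_eq] at hx' hmin
  have hx't : f x' ≠ ⊤ := by
    intro h
    rw [tilt_eq_coe hc, tilt, h, EReal.top_sub_coe, EReal.top_add_coe, top_le_iff] at hx'
    exact EReal.coe_ne_top _ hx'
  obtain ⟨c', hc'⟩ := exists_eq_coe hbot hx't
  rw [tilt_eq_coe hc, tilt_eq_coe hc'] at hx'
  rw [tilt_eq_coe hc'] at hle
  norm_cast at hx' hle
  have hdist : dist x x' < D / 2 := by
    have : 2 * e / D * dist x x' < 2 * e / D * (D / 2) := by
      rw [show 2 * e / D * (D / 2) = e by field_simp]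
      linarith
    exact lt_of_mul_lt_mul_left this (by positivity)
  have hx'a : dist x' a < dist x a + D / 2 := by
    have := dist_triangle_left x' a x
    linarith
  obtain ⟨v, hv, hvu⟩ := exists_mem_subdiff_of_minorant hbot hlsc hx't (u := u) (l := 2 * e / D)
    (by positivity) (show 0 < R - (dist x a + D / 2) by linarith) (by
      intro y hy
      rw [mem_ball] at hy
      have hya : dist y a ≤ R := by linarith [dist_triangle y x' a]
      have h1 := hmin ⟨y, hya⟩
      by_cases hyt : f y = ⊤
      · rw [hyt]; exact le_top
      obtain ⟨cy, hcy⟩ := exists_eq_coe hbot hyt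
      simp only [tilt_eq_coe hc', tilt_eq_coe hcy] at h1
      rw [hc', hcy, map_sub, ← dist_eq_norm, dist_comm]
      norm_cast at h1 ⊢
      linarith)
  obtain ⟨hne, hg1⟩ := hreg x' (by rw [mem_ball]; linarith) u (mem_ball_zero_iff.2 hu) ⟨v, hv⟩
  have h1 : infDist u (subdiff f x') ≤ 2 * e / D := by
    refine (infDist_le_dist_of_mem hv).trans ?_
    rwa [dist_comm, dist_eq_norm]
  -- Ekeland's point has used up less than half of the distance to the critical set.
  have h2 : D / 2 ≤ infDist x' (invMulti (subdiff f) u) := (le_infDist hne).2 fun y hy => by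
    have := hDS y hy
    have := dist_triangle x x' y
    linarith
  have h3 : g (τ / 2 * D) ≤ κ * (2 * e / D) := by
    refine (hg.mono (by positivity) ?_).trans (hg1.trans (by gcongr))
    rw [div_mul_eq_mul_div, mul_div_assoc]
    gcongr
  refine (hg.le_mul _ (by positivity)).trans ?_
  calc τ / 2 * D * g (τ / 2 * D) ≤ τ / 2 * D * (κ * (2 * e / D)) := by gcongr
    _ = τ * κ * e := by field_simp

/-- Solutions of the regular inclusion near the reference point. -/
theorem RegIneq.exists_near (hg : IsRate φ g) {r τ κ : ℝ} (hr : 0 < r) (hτ : 0 < τ)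
    (hreg : RegIneq g (subdiff f) a 0 r τ κ) (hκ : 0 < κ)
    (h0 : 0 ∈ subdiff f a) {ρ : ℝ} (hρ : 0 < ρ) {u : StrongDual ℝ X} (hu : ‖u‖ < r)
    (huρ : κ * ‖u‖ < g (τ * ρ)) : ∃ z, u ∈ subdiff f z ∧ dist z a < ρ := by
  obtain ⟨hne, hle⟩ := hreg a (mem_ball_self hr) u (mem_ball_zero_iff.2 hu) ⟨0, h0⟩
  have h1 : infDist u (subdiff f a) ≤ ‖u‖ :=
    (infDist_le_dist_of_mem h0).trans_eq (dist_zero_right u)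
  have h2 : κ * infDist u (subdiff f a) ≤ κ * ‖u‖ := by gcongr
  have h3 := lt_of_mul_lt_mul_left
    (hg.lt_of_lt (by positivity) ((hle.trans h2).trans_lt huρ)) hτ.le
  obtain ⟨z, hz, hlt⟩ := (infDist_lt_iff hne).1 h3
  exact ⟨z, hz, by rwa [dist_comm]⟩

/-- Growth at `u = 0`, available by local minimality, confines almost minimizers of `f - u` near
`a`. The growth estimate for `u` then forces them towards `z u`, and lower semicontinuity makes `z
u` a minimizer. -/
theorem StrongMetricRegular.slwp [CompleteSpace X] (hg : IsRate φ g) (hbot : ∀ x, f x ≠ ⊥)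
    (hlsc : LowerSemicontinuous f) (hfa : f a ≠ ⊤) (hmin : IsLocalMin f a)
    (h : StrongMetricRegular g (subdiff f) a 0) : SLWP φ f a := by
  obtain ⟨h0, r, τ, κ, δ, hr, hτ, hκ, hδ, hreg, hsing⟩ := h
  choose! z hz using hsing
  obtain ⟨R, hR, hminR⟩ := nhds_basis_closedBall.eventually_iff.1 hmin
  obtain ⟨ca, hca⟩ := exists_eq_coe hbot hfa
  have hz0 : z 0 = a := by
    have : a ∈ invMulti (subdiff f) 0 ∩ ball a δ := ⟨h0, mem_ball_self hδ⟩
    rw [hz 0 (mem_ball_self hr)] at this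
    exact (mem_singleton_iff.1 this).symm
  set ρ := min (min r δ) R / 4 with hρ
  have hmin0 : 0 < min (min r δ) R := lt_min (lt_min hr hδ) hR
  have hρ0 : 0 < ρ := by positivity
  have hρr : 4 * ρ ≤ r := by
    rw [hρ]; linarith [min_le_left (min r δ) R, min_le_left r δ]
  have hρδ : 4 * ρ ≤ δ := by
    rw [hρ]; linarith [min_le_left (min r δ) R, min_le_right r δ]
  have hρR : 4 * ρ ≤ R := by
    rw [hρ]; linarith [min_le_right (min r δ) R]
  have hgrow : ∀ (u : StrongDual ℝ X) (x : X) (c m σ R' : ℝ), ‖u‖ < r → σ ≤ ρ →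
      dist (z u) a ≤ σ → dist x a ≤ σ → f x = c → 2 * σ < R' →
      (∀ y ∈ closedBall a R', ((m + u y : ℝ) : EReal) ≤ f y) →
      φ (τ / 2 * ‖x - z u‖) ≤ τ * κ * (c - u x - m) := by
    intro u x c m σ R' hu hσ hzσ hxσ hc hσR hm
    rw [← dist_eq_norm]
    have htri := dist_triangle_right x (z u) a
    rcases (dist_nonneg (x := x) (y := z u)).eq_or_lt with hd | hd
    · rw [← hd, mul_zero, hg.gauge_zero]
      have := hm x (by rw [mem_closedBall]; linarith [dist_nonneg (x := x) (y := a)])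
      rw [hc] at this
      norm_cast at this
      have h1 : 0 ≤ c - u x - m := by linarith
      positivity
    refine hreg.gauge_le hg hbot hlsc hτ hκ hm hu hd (fun y hy => ?_) (by linarith) (by linarith) hc
    -- Within `ball a δ` the only critical point is `z u`; those outside are farther from `x` than
    -- `z u` is.
    by_cases hyδ : y ∈ ball a δ
    · have : y ∈ invMulti (subdiff f) u ∩ ball a δ := ⟨hy, hyδ⟩
      rw [hz u (mem_ball_zero_iff.2 hu)] at this
      rw [mem_singleton_iff.1 this]
    · rw [mem_ball, not_lt] at hyδ
      linarith [dist_triangle_left y a x]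
  have hgrow0 : ∀ (x : X) (c : ℝ), dist x a ≤ ρ → f x = c →
      φ (τ / 2 * ‖x - a‖) ≤ τ * κ * (c - ca) := by
    intro x c hx hc
    have := hgrow 0 x c ca ρ R (by simpa using hr) le_rfl (by simpa [hz0] using hρ0.le) hx hc
      (by linarith) (fun y hy => by
        have := hminR hy
        rw [hca] at this
        simpa using this)
    simpa [hz0] using this
  set σ := ρ / 4 with hσ
  have hσ0 : 0 < σ := by positivity
  have hgσ := hg.pos (show 0 < τ / 4 * σ by positivity)
  have hgσ' := hg.pos (show 0 < τ * σ by positivity)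
  have hgauge : ∀ {s t e : ℝ}, 0 ≤ s → 0 < t → φ (τ / 2 * s) ≤ τ * κ * e →
      e < t * g (τ / 4 * t) / (4 * κ) → s < t := by
    intro s t e hs ht hle hlt
    rw [lt_div_iff₀ (by positivity)] at hlt
    have := hg.lt_of_gauge_lt (s := τ / 4 * s) (t := τ / 4 * t) (by positivity) (by positivity)
      (by
        rw [show 2 * (τ / 4 * s) = τ / 2 * s by ring]
        refine hle.trans_lt ?_
        nlinarith)
    exact lt_of_mul_lt_mul_left this (by positivity)
  -- An excess below `β` at tilt zero forces a point into the `σ`-ball; the tilt takes less than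
  -- half of this budget and `e` at most the other half.
  set β := σ * g (τ / 4 * σ) / (4 * κ) with hβ
  have hβ0 : 0 < β := by positivity
  refine (slwp_iff hbot).2 ⟨min r (min (g (τ * σ) / κ) (β / (2 * ρ))), σ, τ * κ, τ / 2,
    by positivity, hσ0, by positivity, by positivity, z, hz0, fun u hu => ?_⟩
  rw [mem_ball_zero_iff, lt_min_iff, lt_min_iff, lt_div_iff₀' hκ, lt_div_iff₀ (by positivity)] at hu
  obtain ⟨hur, huσ, huβ⟩ := hu
  have hzσ : dist (z u) a < σ := by
    obtain ⟨y, hy, hya⟩ := hreg.exists_near hg hr hτ hκ h0 hσ0 hur huσ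
    have : y ∈ invMulti (subdiff f) u ∩ ball a δ := ⟨hy, by rw [mem_ball]; linarith⟩
    rw [hz u (mem_ball_zero_iff.2 hur)] at this
    rwa [← mem_singleton_iff.1 this]
  obtain ⟨m, hm⟩ : ∃ m : ℝ, ⨅ y ∈ closedBall a ρ, tilt f u y = m := by
    refine ⟨_, (EReal.coe_toReal ?_ ?_).symm⟩
    · refine ne_top_of_le_ne_top (EReal.coe_ne_top (ca - u a)) ?_
      rw [← tilt_eq_coe hca]
      exact iInf₂_le a (mem_closedBall_self hρ0.le)
    · refine ne_bot_of_le_ne_bot (EReal.coe_ne_bot (ca - u a - ‖u‖ * ρ)) (le_iInf₂ fun y hy => ?_)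
      have h1 : (ca : EReal) ≤ f y := by
        rw [← hca]
        exact hminR (closedBall_subset_closedBall (by linarith) hy)
      refine coe_le_tilt_iff.2 (le_trans ?_ h1)
      have h2 := apply_le_norm_mul u (y - a)
      rw [mem_closedBall, dist_eq_norm] at hy
      have h3 : ‖u‖ * ‖y - a‖ ≤ ‖u‖ * ρ := by gcongr
      rw [map_sub] at h2
      exact_mod_cast (by linarith : ca - u a - ‖u‖ * ρ + u y ≤ ca)
  have hmle : ∀ y ∈ closedBall a ρ, ((m + u y : ℝ) : EReal) ≤ f y := fun y hy => by
    rw [← coe_le_tilt_iff, ← hm]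
    exact iInf₂_le y hy
  have hma : m + u a ≤ ca := by
    have := hmle a (mem_closedBall_self hρ0.le)
    rw [hca] at this
    exact_mod_cast this
  have hzm : tilt f u (z u) ≤ m := by
    by_contra! hlt
    obtain ⟨b, hmb, hbz⟩ := EReal.lt_iff_exists_real_btwn.1 hlt
    obtain ⟨η, hη, hlow⟩ := Metric.eventually_nhds_iff.1
      (lowerSemicontinuous_tilt hlsc u (z u) b hbz)
    norm_cast at hmb
    have hgη := hg.pos (show 0 < τ / 4 * η by positivity)
    -- The three bounds put `y` below the level `b`, in the `σ`-ball, and within `η` of `z u`, where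
    -- `f - u` exceeds `b`.
    set e := min (b - m) (min (β / 2) (η * g (τ / 4 * η) / (4 * κ))) with he
    have he0 : 0 < e := lt_min (by linarith) (by positivity)
    have hlt' : ⨅ y ∈ closedBall a ρ, tilt f u y < ((m + e : ℝ) : EReal) := by
      rw [hm]; exact_mod_cast (by linarith : m < m + e)
    simp only [iInf_lt_iff] at hlt'
    obtain ⟨y, hy, hylt⟩ := hlt'
    have hyt : f y ≠ ⊤ := by
      intro h
      rw [tilt, h, EReal.top_sub_coe] at hylt
      exact not_top_lt hylt
    obtain ⟨c, hc⟩ := exists_eq_coe hbot hyt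
    rw [tilt_eq_coe hc] at hylt
    norm_cast at hylt
    have hyσ : dist y a ≤ σ := by
      rw [dist_eq_norm]
      refine (hgauge (norm_nonneg _) hσ0 (hgrow0 y c hy hc) ?_).le
      have h1 := apply_le_norm_mul u (y - a)
      rw [mem_closedBall, dist_eq_norm] at hy
      have h2 : ‖u‖ * ‖y - a‖ ≤ ‖u‖ * ρ := by gcongr
      rw [map_sub] at h1
      have h3 : e ≤ β / 2 := (min_le_right _ _).trans (min_le_left _ _)
      linarith
    have hyη : ‖y - z u‖ < η :=
      hgauge (norm_nonneg _) hη
        (hgrow u y c m σ ρ hur (by linarith) hzσ.le hyσ hc (by linarith) hmle)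
        (lt_of_lt_of_le (by linarith : c - u y - m < e)
          ((min_le_right _ _).trans (min_le_right _ _)))
    have hby : (b : EReal) < tilt f u y := hlow (by rwa [dist_eq_norm])
    rw [tilt_eq_coe hc] at hby
    norm_cast at hby
    have h3 : e ≤ b - m := min_le_left _ _
    linarith
  have hzt : f (z u) ≠ ⊤ := by
    intro h
    rw [tilt, h, EReal.top_sub_coe, top_le_iff] at hzm
    exact EReal.coe_ne_top _ hzm
  obtain ⟨cz, hcz⟩ := exists_eq_coe hbot hzt
  rw [tilt_eq_coe hcz] at hzm
  norm_cast at hzm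
  refine ⟨hzσ.le, hzt, fun x hx => ?_⟩
  by_cases hxt : f x = ⊤
  · rw [hxt]; exact le_top
  obtain ⟨c, hc⟩ := exists_eq_coe hbot hxt
  have h1 := hgrow u x c m σ ρ hur (by linarith) hzσ.le hx hc (by linarith) hmle
  rw [← div_le_iff₀' (by positivity)] at h1
  rw [hcz, hc, map_sub]
  exact_mod_cast (by linarith :
    cz + (φ (τ / 2 * ‖x - z u‖) / (τ * κ) + (u x - u (z u))) ≤ c)

/-- Small tilts keep `m u` interior, hence critical. By convexity `v ∈ ∂f(x)` is a global minimality
condition, so the displacement bound applies to every subgradient. -/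
theorem SLWP.strongMetricRegular (hg : IsRate φ g) (hbot : ∀ x, f x ≠ ⊥)
    (hlsc : LowerSemicontinuous f) (hf : ConvexFun f) (h : SLWP φ f a) :
    StrongMetricRegular g (subdiff f) a 0 := by
  obtain ⟨δ, r, τ, κ, hδ, hr, hτ, hκ, m, hm, h⟩ := (slwp_iff hbot).1 h
  have hgr := hg.pos (show 0 < κ / 2 * r by positivity)
  set δ' := min δ (g (κ / 2 * r) * κ / (2 * τ)) with hδ'
  have hδ'0 : 0 < δ' := by positivity
  have hsub : ∀ u ∈ ball (0 : StrongDual ℝ X) δ', u ∈ subdiff f (m u) ∧ m u ∈ ball a r := by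
    intro u hu
    rw [mem_ball_zero_iff, lt_min_iff, lt_div_iff₀ (by positivity)] at hu
    have hgu := h u (mem_ball_zero_iff.2 hu.1)
    have hmin0 := (h 0 (mem_ball_self hδ)).minorant hg hτ hκ hgu.1
    rw [hm] at hmin0
    have h1 := hgu.rate_le hg hbot hτ hκ (mem_closedBall_self hr.le) hmin0
    rw [zero_sub, norm_neg] at h1
    have h2 : 2 * τ / κ * ‖u‖ < g (κ / 2 * r) := by
      rw [div_mul_eq_mul_div, div_lt_iff₀ hκ]; linarith
    have h3 := lt_of_mul_lt_mul_left (hg.lt_of_lt (by positivity) (h1.trans_lt h2)) (by positivity)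
    have hmem : m u ∈ ball a r := by rwa [mem_ball, dist_comm, dist_eq_norm]
    refine ⟨?_, hmem⟩
    -- The sum rule with `l = 0` returns `u` itself.
    obtain ⟨v, hv, hvu⟩ := exists_mem_subdiff_of_minorant hbot hlsc hgu.2.1 (u := u) le_rfl
      (show 0 < r - dist (m u) a from sub_pos.2 hmem) (fun y hy => by
        simpa using hgu.minorant hg hτ hκ (x := y) (by
          rw [mem_ball] at hy
          rw [mem_closedBall]
          linarith [dist_triangle y (m u) a]))
    rwa [sub_eq_zero.1 (norm_le_zero_iff.1 hvu)] at hv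
  have hgrow : ∀ u ∈ ball (0 : StrongDual ℝ X) δ',
      GrowthAt φ τ κ f u (closedBall a r) (m u) := fun u hu =>
    h u (ball_subset_ball (min_le_left _ _) hu)
  refine ⟨by simpa only [hm] using (hsub 0 (mem_ball_self hδ'0)).1, min δ' r, κ / 2, 2 * τ / κ, r,
    lt_min hδ'0 hr, by positivity, by positivity, hr, ?_, ?_⟩
  · intro x hx u hu hne
    replace hu := ball_subset_ball (min_le_left _ _) hu
    replace hx := ball_subset_ball (min_le_right _ _) hx
    have hmu : m u ∈ invMulti (subdiff f) u := (hsub u hu).1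
    refine ⟨⟨_, hmu⟩, ?_⟩
    rw [← div_le_iff₀' (by positivity), le_infDist hne]
    intro v hv
    rw [div_le_iff₀' (by positivity), dist_comm, dist_eq_norm]
    refine (hg.mono (mul_nonneg (by positivity) infDist_nonneg) ?_).trans
      ((hgrow u hu).rate_le hg hbot hτ hκ (ball_subset_closedBall hx)
        (((hf.mem_subdiff_iff hbot).1 hv).2 (m u)))
    rw [← dist_eq_norm]
    gcongr
    exact infDist_le_dist_of_mem hmu
  · intro u hu
    replace hu := ball_subset_ball (min_le_left _ _) hu
    refine ⟨m u, Subset.antisymm ?_ (singleton_subset_iff.2 (hsub u hu))⟩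
    rintro x ⟨hxu, hxr⟩
    exact (hgrow u hu).eq_of_le hg hbot hτ hκ (ball_subset_closedBall hxr)
      (((hf.mem_subdiff_iff hbot).1 hxu).2 (m u))

/-- Regularity supplies a critical point `z` near `a`, a global minimizer by convexity. Critical
points outside the ball of radius `4 * γ` are farther from `x` than `z`, so only the argmin in the
ball matters. -/
theorem MetricRegular.swlwp [CompleteSpace X] (hg : IsRate φ g) (hbot : ∀ x, f x ≠ ⊥)
    (hlsc : LowerSemicontinuous f) (hf : ConvexFun f) (h : MetricRegular g (subdiff f) a 0) :
    SWLWP φ f a := by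
  obtain ⟨h0, r, τ, κ, hr, hτ, hκ, hreg⟩ := h
  set γ := r / 8 with hγ
  have hγ0 : 0 < γ := by positivity
  have hgγ := hg.pos (show 0 < τ * γ by positivity)
  have h0' := ((hf.mem_subdiff_iff hbot).1 h0).2
  refine ⟨4 * γ, γ, min r (g (τ * γ) / κ), τ / 2, τ * κ, by positivity, hγ0, by positivity,
    by positivity, by positivity, ⟨mem_closedBall_self (by positivity), fun y _ => by
      simpa using h0' y⟩, fun x hx u hu => ?_⟩
  rw [mem_ball_zero_iff, lt_min_iff, lt_div_iff₀' hκ] at hu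
  obtain ⟨z, hz, hza⟩ := hreg.exists_near hg hr hτ hκ h0 hγ0 hu.1 hu.2
  rw [mem_ball] at hx
  have hz' := (hf.mem_subdiff_iff hbot).1 hz
  have hsub : ∀ y ∈ closedBall a (4 * γ), u ∈ subdiff f y →
      y ∈ argminOn (tilt f u) (closedBall a (4 * γ)) := fun y hy hyu =>
    (mem_argminOn_tilt_iff hbot).2 ⟨hy, fun w _ => ((hf.mem_subdiff_iff hbot).1 hyu).2 w⟩
  have hzA := hsub z (by rw [mem_closedBall]; linarith) hz
  refine ⟨⟨z, hzA⟩, ?_⟩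
  rw [iInf_eq_of_mem_argminOn hzA,
    coe_le_mul_tilt_sub_tilt_iff (hbot x) (hbot z) (by positivity)]
  refine ⟨hz'.1, ?_⟩
  by_cases hxt : f x = ⊤
  · rw [hxt]; exact le_top
  obtain ⟨c, hc⟩ := exists_eq_coe hbot hxt
  obtain ⟨cz, hcz⟩ := exists_eq_coe hbot hz'.1
  set D := infDist x (argminOn (tilt f u) (closedBall a (4 * γ))) with hD
  have hxz : dist x z < 2 * γ := by linarith [dist_triangle_right x z a]
  have hDz : D ≤ dist x z := infDist_le_dist_of_mem hzA
  suffices φ (τ / 2 * D) ≤ τ * κ * (c - u x - (cz - u z)) by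
    rw [← div_le_iff₀' (by positivity)] at this
    rw [hcz, hc, map_sub]
    exact_mod_cast (by linarith : cz + (φ (τ / 2 * D) / (τ * κ) + (u x - u z)) ≤ c)
  have hminor : ∀ y, ((cz - u z + u y : ℝ) : EReal) ≤ f y := fun y => by
    refine le_trans (le_of_eq ?_) (hz'.2 y)
    rw [hcz, map_sub]
    norm_cast
    ring
  have hD0 : 0 ≤ D := infDist_nonneg
  rcases hD0.eq_or_lt with hD1 | hD1
  · rw [← hD1, mul_zero, hg.gauge_zero]
    have := hminor x
    rw [hc] at this
    norm_cast at this
    have h1 : 0 ≤ c - u x - (cz - u z) := by linarith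
    positivity
  refine hreg.gauge_le hg hbot hlsc hτ hκ (R := r) (fun y _ => hminor y) hu.1 hD1 (fun y hy => ?_)
    (by linarith) (by linarith) hc
  by_cases hya : y ∈ closedBall a (4 * γ)
  · exact infDist_le_dist_of_mem (hsub y hya hy)
  · rw [mem_closedBall, not_le] at hya
    linarith [dist_triangle_left y a x]

end MetricRegularity

end TiltStability

/-! ### Assembly of the implications. -/

theorem corollary5p3 {X : Type*} [NormedAddCommGroup X] [NormedSpace ℝ X] [CompleteSpace X]
    (φ : ℝ → ℝ) (hφ : TiltStability.IsAdmissible φ)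
    (hdiff : DifferentiableOn ℝ φ (Set.Ici 0)) (hconv : StrictConvexOn ℝ (Set.Ici 0) φ)
    (hzero : TiltStability.derivPos φ 0 = 0)
    (f : X → EReal) (hbot : ∀ x, f x ≠ ⊥) (hlsc : LowerSemicontinuous f)
    (a : X) (ha : f a ≠ ⊤) :
    (TiltStability.SLWP φ f a ↔ TiltStability.SWLWP φ f a) ∧
    (TiltStability.SWLWP φ f a ↔
      TiltStability.TSLM (TiltStability.invPos (TiltStability.derivPos φ)) f a) ∧
    (TiltStability.TSLM (TiltStability.invPos (TiltStability.derivPos φ)) f a ↔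
      TiltStability.WeakTSLM (TiltStability.invPos (TiltStability.derivPos φ)) f a) ∧
    (IsLocalMin f a →
      TiltStability.StrongMetricRegular (TiltStability.derivPos φ)
        (TiltStability.subdiff f) a 0 →
      TiltStability.WeakTSLM (TiltStability.invPos (TiltStability.derivPos φ)) f a) ∧
    (TiltStability.StrongMetricRegular (TiltStability.derivPos φ)
        (TiltStability.subdiff f) a 0 →
      TiltStability.MetricRegular (TiltStability.derivPos φ)
        (TiltStability.subdiff f) a 0) ∧
    (TiltStability.ConvexFun f →
      List.TFAE
        [TiltStability.SLWP φ f a,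
         TiltStability.SWLWP φ f a,
         TiltStability.TSLM (TiltStability.invPos (TiltStability.derivPos φ)) f a,
         TiltStability.WeakTSLM (TiltStability.invPos (TiltStability.derivPos φ)) f a,
         TiltStability.StrongMetricRegular (TiltStability.derivPos φ)
           (TiltStability.subdiff f) a 0,
         TiltStability.MetricRegular (TiltStability.derivPos φ)
           (TiltStability.subdiff f) a 0]) := by
  have hg := TiltStability.isRate_derivPos hφ hdiff hconv hzero
  have h12 := TiltStability.SLWP.swlwp (a := a) hg hbot
  have h24 := TiltStability.SWLWP.weakTSLM (a := a) hg hbot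
  have h43 := TiltStability.WeakTSLM.tslm hg hbot ha
  have h31 := TiltStability.TSLM.slwp hg hbot ha
  refine ⟨⟨h12, fun h => h31 (h43 (h24 h))⟩, ⟨fun h => h43 (h24 h), fun h => h12 (h31 h)⟩,
    ⟨fun h => h24 (h12 (h31 h)), h43⟩, fun hmin h => h24 (h12 (h.slwp hg hbot hlsc ha hmin)),
    fun h => ?_, fun hf => ?_⟩
  · obtain ⟨h0, r, τ, κ, -, hr, hτ, hκ, -, hreg, -⟩ := h
    exact ⟨h0, r, τ, κ, hr, hτ, hκ, hreg⟩
  · tfae_have 1 → 2 := h12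
    tfae_have 2 → 4 := h24
    tfae_have 4 → 3 := h43
    tfae_have 3 → 1 := h31
    tfae_have 1 → 5 := TiltStability.SLWP.strongMetricRegular hg hbot hlsc hf
    tfae_have 5 → 6 := by
      rintro ⟨h0, r, τ, κ, -, hr, hτ, hκ, -, hreg, -⟩
      exact ⟨h0, r, τ, κ, hr, hτ, hκ, hreg⟩
    tfae_have 6 → 2 := TiltStability.MetricRegular.swlwp hg hbot hlsc hf
    tfae_finish
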